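/- Let $A$ be a complex Banach algebra with unit. Write $M_\infty(A)=\bigcup_{n} M_n(A)$ (inclusions $x\mapsto\begin{pmatrix}x&0\\0&0\end{pmatrix}$) and $GL_\infty(A)=\bigcup_{n} GL_n(A)$ (inclusions $x\mapsto\begin{pmatrix}x&0\\0&1\end{pmatrix}$), the latter with the inductive limit topology; let $GL_\infty^0(A)$ be the connected component of $1$ in $GL_\infty(A)$. Let $\tau:A\to\mathbf C$ be a trace, that is, a continuous linear form with $\tau(yx)=\tau(xy)$ for all $x,y\in A$; extend it to $M_\infty(A)$ by $\tau(x)=\sum_j\tau(x_{j,j})$, and let $\underline\tau:K_0(A)\to\mathbf C$, $[e]\mapsto\tau(e)$, be the induced homomorphism, where $K_0(A)$ is the Grothendieck group of the semigroup of equivalence classes of idempotents $e\in M_\infty(A)$ (two idempotents are equivalent if they are conjugate under some $GL_n(A)$; addition is the block sum). For a piecewise differentiable (continuous, piecewise $C^1$) path $\xi:[a,b]\to GL_\infty^0(A)$ lying in some $GL_n(A)$, put $$\widetilde\Delta_\tau(\xi)=\frac1{2\pi i}\int_a^b\tau\big(\dot\xi(\alpha)\xi(\alpha)^{-1}\big)\,d\alpha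 ,$$ and for $x\in GL_\infty^0(A)$ let $\Delta_\tau(x)\in\mathbf C/\underline\tau(K_0(A))$ be the class of $\widetilde\Delta_\tau(\xi)$, where $\xi$ is any such path from $1$ to $x$. Assume that $\underline\tau(K_0(A))=\mathbf Z$. Then $\Delta_\tau$ is well defined (for every $x\in GL_\infty^0(A)$ such a path exists, and the class does not depend on the path), the map $$\exp(2\pi i\Delta_\tau):GL_\infty^0(A)\longrightarrow\mathbf C^*$$ is a homomorphism of groups, and for every $y\in M_\infty(A)$ one has $e^y\in GL_\infty^0(A)$ and $$\exp(2\pi i\Delta_\tau)(e^y)=e^{\tau(y)} .$$ In particular, if $A=\mathbf C$ and $\tau$ is the identity, then $\underline\tau(K_0(\mathbf C))=\mathbf Z$, $GL_\infty^0(\mathbf C)=GL_\infty(\mathbf C)$, and $\exp(2\pi i\Delta_\tau)$ is the usual determinant on $GL_\infty(\mathbf C)$. -/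

import Mathlib

open scoped Matrix

noncomputable section

namespace BanachDet

/-! ### Inclusions between matrix rings -/

section Pad

variable {R : Type*} [Ring R]

/-- The inclusion `x ↦ (x 0; 0 0)` of `M_k(R)` into `M_n(R)`, for `k ≤ n`. -/
def padZero {k : ℕ} (n : ℕ) (x : Matrix (Fin k) (Fin k) R) : Matrix (Fin n) (Fin n) R :=
  Matrix.of fun i j => if h : i.1 < k ∧ j.1 < k then x ⟨i.1, h.1⟩ ⟨j.1, h.2⟩ else 0

/-- The inclusion `x ↦ (x 0; 0 1)` of `M_k(R)` into `M_n(R)`, for `k ≤ n`. -/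
def padOne {k : ℕ} (n : ℕ) (x : Matrix (Fin k) (Fin k) R) : Matrix (Fin n) (Fin n) R :=
  Matrix.of fun i j => if h : i.1 < k ∧ j.1 < k then x ⟨i.1, h.1⟩ ⟨j.1, h.2⟩
    else if i = j then 1 else 0

/-- The `n × k` matrix of the inclusion `R^k ⊆ R^n`. -/
def inclMat (R : Type*) [Ring R] {k n : ℕ} (h : k ≤ n) : Matrix (Fin n) (Fin k) R :=
  (1 : Matrix (Fin n) (Fin n) R).submatrix id (Fin.castLE h)

theorem inclMat_apply {k n : ℕ} (h : k ≤ n) (i : Fin n) (p : Fin k) :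
    inclMat R h i p = if i.1 = p.1 then 1 else 0 := by
  simp [inclMat, Matrix.one_apply, Fin.ext_iff]

theorem inclMat_transpose_mul {k n : ℕ} (h : k ≤ n) :
    (inclMat R h)ᵀ * inclMat R h = 1 := by
  ext i j
  have key : ∀ x : Fin n, (x.1 = i.1) = (x = Fin.castLE h i) := by
    intro x; simp [Fin.ext_iff]
  simp only [Matrix.mul_apply, Matrix.transpose_apply, inclMat_apply, key, ite_mul, one_mul,
    zero_mul, Finset.sum_ite_eq', Finset.mem_univ, if_true]
  simp [Matrix.one_apply, Fin.ext_iff]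

theorem padZero_eq {k n : ℕ} (h : k ≤ n) (x : Matrix (Fin k) (Fin k) R) :
    padZero n x = inclMat R h * x * (inclMat R h)ᵀ := by
  ext i j
  simp only [Matrix.mul_apply, Matrix.transpose_apply, inclMat_apply, padZero, Matrix.of_apply]
  by_cases hi : i.1 < k
  · have e1 : ∀ p : Fin k, (i.1 = p.1) = ((⟨i.1, hi⟩ : Fin k) = p) := by
      intro p; simp [Fin.ext_iff]
    simp only [e1]
    by_cases hj : j.1 < k
    · have e2 : ∀ p : Fin k, (j.1 = p.1) = ((⟨j.1, hj⟩ : Fin k) = p) := by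
        intro p; simp [Fin.ext_iff]
      simp [e2, hi, hj]
    · have e2 : ∀ p : Fin k, ¬ (j.1 = p.1) := by intro p; omega
      simp [e2, hj]
  · have e1 : ∀ p : Fin k, ¬ (i.1 = p.1) := by intro p; omega
    simp [e1, hi]

theorem padOne_eq {k n : ℕ} (x : Matrix (Fin k) (Fin k) R) :
    padOne n x = padZero n x + (1 - padZero n (1 : Matrix (Fin k) (Fin k) R)) := by
  ext i j
  simp only [padOne, padZero, Matrix.of_apply, Matrix.add_apply, Matrix.sub_apply,
    Matrix.one_apply, Fin.ext_iff]
  split_ifs <;> simp_all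

theorem padZero_mul {k n : ℕ} (h : k ≤ n) (x y : Matrix (Fin k) (Fin k) R) :
    padZero n (x * y) = padZero n x * padZero n y := by
  have := inclMat_transpose_mul (R := R) h
  simp only [padZero_eq h]
  calc inclMat R h * (x * y) * (inclMat R h)ᵀ
      = inclMat R h * x * (1 : Matrix (Fin k) (Fin k) R) * y * (inclMat R h)ᵀ := by simp only [Matrix.mul_assoc, Matrix.one_mul]
    _ = _ := by rw [← this]; simp only [Matrix.mul_assoc]

theorem padOne_mul {k n : ℕ} (h : k ≤ n) (x y : Matrix (Fin k) (Fin k) R) :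
    padOne n (x * y) = padOne n x * padOne n y := by
  have h1 : padZero n x * padZero n (1 : Matrix (Fin k) (Fin k) R) = padZero n x := by
    rw [← padZero_mul h, mul_one]
  have h2 : padZero n (1 : Matrix (Fin k) (Fin k) R) * padZero n y = padZero n y := by
    rw [← padZero_mul h, one_mul]
  have h3 : padZero n (1 : Matrix (Fin k) (Fin k) R) * padZero n (1 : Matrix (Fin k) (Fin k) R)
      = padZero n (1 : Matrix (Fin k) (Fin k) R) := by
    rw [← padZero_mul h, one_mul]
  simp only [padOne_eq, padZero_mul h]
  simp only [mul_add, add_mul, mul_sub, sub_mul, h1, h2, h3, mul_one, one_mul]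
  abel

theorem padOne_one {k n : ℕ} :
    padOne n (1 : Matrix (Fin k) (Fin k) R) = 1 := by
  rw [padOne_eq]; abel

theorem padOne_self {n : ℕ} (x : Matrix (Fin n) (Fin n) R) : padOne n x = x := by
  ext i j; simp [padOne]

theorem padOne_padOne {k m n : ℕ} (h : k ≤ m) (x : Matrix (Fin k) (Fin k) R) :
    padOne n (padOne m x) = padOne n x := by
  ext i j
  simp only [padOne, Matrix.of_apply, Fin.ext_iff]
  split_ifs <;> first | rfl | omega

end Pad

/-! ### The group `K_0(R)` -/

section KZero

variable (R : Type*) [Ring R]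

/-- Idempotent matrices over `R`, of all sizes. -/
structure Idem where
  size : ℕ
  mat : Matrix (Fin size) (Fin size) R
  idem : mat * mat = mat

variable {R}

/-- `e` and `f` are equivalent if, in some `M_n(R)` containing both,
`f = u⁻¹ e u` for some `u ∈ GL_n(R)`. -/
def Idem.Equivalent (e f : Idem R) : Prop :=
  ∃ n : ℕ, e.size ≤ n ∧ f.size ≤ n ∧ ∃ u : (Matrix (Fin n) (Fin n) R)ˣ,
    padZero n f.mat = (↑u⁻¹ : Matrix (Fin n) (Fin n) R) * padZero n e.mat * (u : Matrix (Fin n) (Fin n) R)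

theorem padZero_fromBlocks {k l n : ℕ} (E : Fin k ⊕ Fin l ≃ Fin n)
    (hE : ∀ p, (E (Sum.inl p)).1 = p.1) (e : Matrix (Fin k) (Fin k) R) :
    padZero n e = (Matrix.fromBlocks e 0 0 0).submatrix E.symm E.symm := by
  have hE' : ∀ q, ¬ (E (Sum.inr q)).1 < k := by
    intro q hq
    have : E (Sum.inl ⟨_, hq⟩) = E (Sum.inr q) := Fin.ext (hE _)
    simpa using E.injective this
  ext i j
  obtain ⟨i, rfl⟩ := E.surjective i
  obtain ⟨j, rfl⟩ := E.surjective j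
  rcases i with i | i <;> rcases j with j | j <;> simp [padZero, hE, hE']

/-- Helper: equivalence of idempotents through rectangular matrices. -/
theorem Idem.equivalent_iff (e f : Idem R) : e.Equivalent f ↔
    ∃ (a : Matrix (Fin e.size) (Fin f.size) R) (b : Matrix (Fin f.size) (Fin e.size) R),
      a * b = e.mat ∧ b * a = f.mat := by
  have he := e.idem
  have hf := f.idem
  constructor
  · rintro ⟨n, hk, hl, u, hu⟩
    set J : Matrix (Fin n) (Fin e.size) R := inclMat R hk with hJ
    set L : Matrix (Fin n) (Fin f.size) R := inclMat R hl with hL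
    have hJ1 : Jᵀ * J = 1 := inclMat_transpose_mul hk
    have hL1 : Lᵀ * L = 1 := inclMat_transpose_mul hl
    rw [padZero_eq hk, padZero_eq hl] at hu
    have hu' : (u : Matrix (Fin n) (Fin n) R) * (L * f.mat * Lᵀ) *
        (↑u⁻¹ : Matrix (Fin n) (Fin n) R) = J * e.mat * Jᵀ := by
      rw [hu]; simp [J, ← mul_assoc]
    refine ⟨e.mat * Jᵀ * (u : Matrix (Fin n) (Fin n) R) * L, f.mat * Lᵀ * (↑u⁻¹ : Matrix (Fin n) (Fin n) R) * J, ?_, ?_⟩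
    · calc _ = e.mat * Jᵀ * ((u : Matrix (Fin n) (Fin n) R) * (L * f.mat * Lᵀ) *
              (↑u⁻¹ : Matrix (Fin n) (Fin n) R)) * J := by
            simp only [Matrix.mul_assoc]
        _ = e.mat * (Jᵀ * J) * e.mat * (Jᵀ * J) := by rw [hu']; simp only [Matrix.mul_assoc]
        _ = e.mat := by rw [hJ1]; simp [he]
    · calc _ = f.mat * Lᵀ * ((↑u⁻¹ : Matrix (Fin n) (Fin n) R) * (J * e.mat * Jᵀ) *
              (u : Matrix (Fin n) (Fin n) R)) * L := by
            simp only [Matrix.mul_assoc]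
        _ = f.mat * (Lᵀ * L) * f.mat * (Lᵀ * L) := by rw [← hu]; simp only [L, Matrix.mul_assoc]
        _ = f.mat := by rw [hL1]; simp [hf]
  · rintro ⟨a', b', hab', hba'⟩
    obtain ⟨a, b, hab, hba, ea, af, be, fb⟩ :
        ∃ (a : Matrix (Fin e.size) (Fin f.size) R) (b : Matrix (Fin f.size) (Fin e.size) R),
          a * b = e.mat ∧ b * a = f.mat ∧ e.mat * a = a ∧ a * f.mat = a ∧ b * e.mat = b
          ∧ f.mat * b = b := by
      have hc : a' * f.mat = e.mat * a' := by rw [← hab', ← hba', Matrix.mul_assoc]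
      have hd : b' * e.mat = f.mat * b' := by rw [← hab', ← hba', Matrix.mul_assoc]
      refine ⟨e.mat * a', f.mat * b', ?_, ?_, ?_, ?_, ?_, ?_⟩
      · calc _ = e.mat * (a' * f.mat) * b' := by simp only [Matrix.mul_assoc]
          _ = (e.mat * e.mat) * (a' * b') := by rw [hc]; simp only [Matrix.mul_assoc]
          _ = _ := by rw [he, hab', he]
      · calc _ = f.mat * (b' * e.mat) * a' := by simp only [Matrix.mul_assoc]
          _ = (f.mat * f.mat) * (b' * a') := by rw [hd]; simp only [Matrix.mul_assoc]
          _ = _ := by rw [hf, hba', hf]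
      · rw [← Matrix.mul_assoc, he]
      · rw [Matrix.mul_assoc, hc, ← Matrix.mul_assoc, he]
      · rw [Matrix.mul_assoc, hd, ← Matrix.mul_assoc, hf]
      · rw [← Matrix.mul_assoc, hf]
    set E₁ : Fin e.size ⊕ Fin f.size ≃ Fin (e.size + f.size) := finSumFinEquiv
    set E₂ : Fin f.size ⊕ Fin e.size ≃ Fin (e.size + f.size) :=
      finSumFinEquiv.trans (finCongr (Nat.add_comm _ _))
    let U := (Matrix.fromBlocks a (1 - e.mat) (1 - f.mat) b).submatrix E₁.symm E₂.symm
    let V := (Matrix.fromBlocks b (1 - f.mat) (1 - e.mat) a).submatrix E₂.symm E₁.symm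
    have hUV : U * V = 1 := by
      simp only [U, V, Matrix.submatrix_mul_equiv, Matrix.fromBlocks_multiply]
      simp only [mul_sub, sub_mul, Matrix.mul_sub, Matrix.sub_mul, hab, hba, ea, af, be, fb, he, hf,
        mul_one, one_mul, Matrix.mul_one, Matrix.one_mul]
      simp [Matrix.fromBlocks_one]
    have hVU : V * U = 1 := by
      simp only [U, V, Matrix.submatrix_mul_equiv, Matrix.fromBlocks_multiply]
      simp only [mul_sub, sub_mul, Matrix.mul_sub, Matrix.sub_mul, hab, hba, ea, af, be, fb, he, hf,
        mul_one, one_mul, Matrix.mul_one, Matrix.one_mul]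
      simp [Matrix.fromBlocks_one]
    refine ⟨e.size + f.size, by omega, by omega, ⟨U, V, hUV, hVU⟩, ?_⟩
    have h1 := padZero_fromBlocks E₁ (fun p => by simp [E₁]) e.mat
    have h2 := padZero_fromBlocks E₂ (fun p => by simp [E₂]) f.mat
    have h3 : U * padZero (e.size + f.size) f.mat = padZero (e.size + f.size) e.mat * U := by
      rw [h1, h2]
      simp only [U, Matrix.submatrix_mul_equiv, Matrix.fromBlocks_multiply]
      simp [Matrix.mul_sub, Matrix.sub_mul, ea, af, hf, he]
    change padZero _ f.mat = V * padZero _ e.mat * U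
    rw [Matrix.mul_assoc, ← h3, ← Matrix.mul_assoc, hVU, Matrix.one_mul]

instance Idem.setoid : Setoid (Idem R) where
  r := Idem.Equivalent
  iseqv := by
    refine ⟨fun e => ⟨e.size, le_rfl, le_rfl, 1, by simp⟩, ?_, ?_⟩
    · intro e f h
      obtain ⟨a, b, h1, h2⟩ := (Idem.equivalent_iff e f).1 h
      exact (Idem.equivalent_iff f e).2 ⟨b, a, h2, h1⟩
    · intro e f g h h'
      obtain ⟨a, b, h1, h2⟩ := (Idem.equivalent_iff e f).1 h
      obtain ⟨c, d, h3, h4⟩ := (Idem.equivalent_iff f g).1 h'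
      refine (Idem.equivalent_iff e g).2 ⟨a * c, d * b, ?_, ?_⟩
      · calc a * c * (d * b) = a * (c * d) * b := by simp only [Matrix.mul_assoc]
          _ = (a * b) * (a * b) := by rw [h3, ← h2]; simp only [Matrix.mul_assoc]
          _ = e.mat := by rw [h1, e.idem]
      · calc d * b * (a * c) = d * (b * a) * c := by simp only [Matrix.mul_assoc]
          _ = (d * c) * (d * c) := by rw [h2, ← h3]; simp only [Matrix.mul_assoc]
          _ = g.mat := by rw [h4, g.idem]

/-- The block sum `x ⊕ y = (x 0; 0 y)`. -/
def blockSum {k k' l l' : ℕ} (x : Matrix (Fin k) (Fin k') R) (y : Matrix (Fin l) (Fin l') R) :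
    Matrix (Fin (k + l)) (Fin (k' + l')) R :=
  (Matrix.fromBlocks x 0 0 y).submatrix finSumFinEquiv.symm finSumFinEquiv.symm

theorem blockSum_mul {k k' k'' l l' l'' : ℕ} (x : Matrix (Fin k) (Fin k') R)
    (y : Matrix (Fin l) (Fin l') R) (x' : Matrix (Fin k') (Fin k'') R)
    (y' : Matrix (Fin l') (Fin l'') R) :
    blockSum x y * blockSum x' y' = blockSum (x * x') (y * y') := by
  simp only [blockSum, Matrix.submatrix_mul_equiv, Matrix.fromBlocks_multiply]
  simp

theorem blockSum_assoc {k l m : ℕ} (x : Matrix (Fin k) (Fin k) R)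
    (y : Matrix (Fin l) (Fin l) R) (z : Matrix (Fin m) (Fin m) R) :
    blockSum x (blockSum y z) = (blockSum (blockSum x y) z).submatrix
      (finCongr (Nat.add_assoc k l m).symm) (finCongr (Nat.add_assoc k l m).symm) := by
  have h1 : ∀ i : Fin k, finCongr (Nat.add_assoc k l m).symm (Fin.castAdd (l + m) i)
      = Fin.castAdd m (Fin.castAdd l i) := fun i => rfl
  have h2 : ∀ i : Fin l, finCongr (Nat.add_assoc k l m).symm (Fin.natAdd k (Fin.castAdd m i))
      = Fin.castAdd m (Fin.natAdd k i) := fun i => rfl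
  have h3 : ∀ i : Fin m, finCongr (Nat.add_assoc k l m).symm (Fin.natAdd k (Fin.natAdd l i))
      = Fin.natAdd (k + l) i := fun i => Fin.ext (by simp [Nat.add_assoc])
  ext i j
  rw [Matrix.submatrix_apply]
  refine Fin.addCases (fun i => ?_) (fun i => Fin.addCases (fun i => ?_) (fun i => ?_) i) i <;>
  refine Fin.addCases (fun j => ?_) (fun j => Fin.addCases (fun j => ?_) (fun j => ?_) j) j <;>
  simp only [h1, h2, h3] <;> simp [blockSum]

theorem blockSum_comm {k l : ℕ} (x : Matrix (Fin k) (Fin k) R) (y : Matrix (Fin l) (Fin l) R) :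
    blockSum y x = (blockSum x y).submatrix
      (finSumFinEquiv.symm.trans ((Equiv.sumComm _ _).trans finSumFinEquiv))
      (finSumFinEquiv.symm.trans ((Equiv.sumComm _ _).trans finSumFinEquiv)) := by
  ext i j
  refine Fin.addCases (fun i => ?_) (fun i => ?_) i <;>
  refine Fin.addCases (fun j => ?_) (fun j => ?_) j <;> simp [blockSum]

theorem blockSum_zero_left {k : ℕ} (x : Matrix (Fin k) (Fin k) R) :
    x = (blockSum (0 : Matrix (Fin 0) (Fin 0) R) x).submatrix
      ((Equiv.emptySum (Fin 0) _).symm.trans finSumFinEquiv)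
      ((Equiv.emptySum (Fin 0) _).symm.trans finSumFinEquiv) := by
  ext i j
  simp only [blockSum, Matrix.submatrix_apply, Equiv.trans_apply, Equiv.symm_apply_apply,
    Equiv.emptySum_symm_apply, Matrix.fromBlocks_apply₂₂]

theorem blockSum_zero_right {k : ℕ} (x : Matrix (Fin k) (Fin k) R) :
    x = (blockSum x (0 : Matrix (Fin 0) (Fin 0) R)).submatrix
      ((Equiv.sumEmpty _ (Fin 0)).symm.trans finSumFinEquiv)
      ((Equiv.sumEmpty _ (Fin 0)).symm.trans finSumFinEquiv) := by
  ext i j; simp [blockSum]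

/-- The block sum of idempotents. -/
def Idem.sum (e f : Idem R) : Idem R where
  size := e.size + f.size
  mat := blockSum e.mat f.mat
  idem := by rw [blockSum_mul, e.idem, f.idem]

/-- The zero idempotent, of size `0`. -/
def Idem.zero : Idem R where
  size := 0
  mat := 0
  idem := by simp

/-- Helper: an idempotent is equivalent to any relabelling of its indices. -/
theorem Idem.equivalent_of_equiv (e f : Idem R) (σ : Fin f.size ≃ Fin e.size)
    (h : f.mat = e.mat.submatrix σ σ) : e.Equivalent f := by
  refine (Idem.equivalent_iff e f).2 ⟨e.mat.submatrix id σ, e.mat.submatrix σ id, ?_, ?_⟩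
  · rw [Matrix.submatrix_mul_equiv, e.idem]; simp
  · rw [h]
    have := Matrix.submatrix_mul_equiv e.mat e.mat σ (Equiv.refl _) σ
    rw [e.idem] at this
    exact this

variable (R)

/-- The semigroup (with zero) of equivalence classes of idempotents of `M_∞(R)`. -/
def IdemClass : Type _ := Quotient (Idem.setoid (R := R))

instance : Zero (IdemClass R) := ⟨Quotient.mk _ Idem.zero⟩

/-- The addition `[e] + [f] = [e ⊕ f]`. -/
instance : Add (IdemClass R) where
  add := Quotient.map₂ Idem.sum (by
    intro e e' he f f' hf
    obtain ⟨a, b, h1, h2⟩ := (Idem.equivalent_iff e e').1 he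
    obtain ⟨c, d, h3, h4⟩ := (Idem.equivalent_iff f f').1 hf
    refine (Idem.equivalent_iff _ _).2 ⟨blockSum a c, blockSum b d, ?_, ?_⟩
    · exact (blockSum_mul a c b d).trans (by rw [h1, h3]; rfl)
    · exact (blockSum_mul b d a c).trans (by rw [h2, h4]; rfl))

instance : AddCommMonoid (IdemClass R) where
  nsmul := nsmulRec
  add_assoc := by
    rintro ⟨e⟩ ⟨f⟩ ⟨g⟩
    exact Quotient.sound (Idem.equivalent_of_equiv _ _ _ (blockSum_assoc e.mat f.mat g.mat))
  zero_add := by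
    rintro ⟨e⟩
    exact Quotient.sound (Idem.equivalent_of_equiv _ _ _ (blockSum_zero_left e.mat))
  add_zero := by
    rintro ⟨e⟩
    exact Quotient.sound (Idem.equivalent_of_equiv _ _ _ (blockSum_zero_right e.mat))
  add_comm := by
    rintro ⟨e⟩ ⟨f⟩
    exact Quotient.sound (Idem.equivalent_of_equiv _ _ _ (blockSum_comm e.mat f.mat))

/-- `K_0(R)`: the Grothendieck group of the semigroup of classes of idempotents. Two idempotents
have the same image in it if and only if they are stably equivalent. -/
abbrev KZero : Type _ := Algebra.GrothendieckAddGroup (IdemClass R)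

end KZero

/-! ### The topological group `GL_∞(A)` -/

section GLInf

/-- The inclusion `GL_k(R) ⊆ GL_n(R)`, `x ↦ (x 0; 0 1)`. -/
def glPad {R : Type*} [Ring R] (k n : ℕ) (h : k ≤ n) :
    (Matrix (Fin k) (Fin k) R)ˣ →* (Matrix (Fin n) (Fin n) R)ˣ :=
  Units.map
    { toFun := padOne n
      map_one' := padOne_one
      map_mul' := padOne_mul h }

instance glPad_directedSystem (R : Type*) [Ring R] :
    DirectedSystem (fun n : ℕ => (Matrix (Fin n) (Fin n) R)ˣ)
      (fun k n h => ⇑(glPad (R := R) k n h)) where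
  map_self _ x := Units.ext (padOne_self x.1)
  map_map _ _ _ hkm _ x := Units.ext (padOne_padOne hkm x.1)

/-- `GL_∞(R) = ⋃ GL_n(R)`. -/
def GLInf (R : Type*) [Ring R] : Type _ :=
  DirectLimit (fun n : ℕ => (Matrix (Fin n) (Fin n) R)ˣ) (glPad (R := R))

instance (R : Type*) [Ring R] : Group (GLInf R) :=
  inferInstanceAs (Group (DirectLimit (fun n : ℕ => (Matrix (Fin n) (Fin n) R)ˣ) (glPad (R := R))))

/-- The inclusion `GL_n(R) ⊆ GL_∞(R)`. -/
def GLInf.of {R : Type*} [Ring R] (n : ℕ) : (Matrix (Fin n) (Fin n) R)ˣ →* GLInf R where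
  toFun x := Quotient.mk _ ⟨n, x⟩
  map_one' := (DirectLimit.one_def (f := glPad (R := R)) n).symm
  map_mul' x y := (DirectLimit.mul_def (f := glPad (R := R)) n x y).symm

theorem GLInf.of_glPad {R : Type*} [Ring R] {k n : ℕ} (h : k ≤ n)
    (x : (Matrix (Fin k) (Fin k) R)ˣ) : GLInf.of n (glPad k n h x) = GLInf.of k x :=
  Quotient.sound ⟨n, le_rfl, h,
    DirectedSystem.map_self' (glPad (R := R)) (glPad (R := R) k n h x)⟩

theorem GLInf.exists_of {R : Type*} [Ring R] (x : GLInf R) : ∃ n y, GLInf.of n y = x := by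
  induction x using Quotient.inductionOn with
  | h x => exact ⟨x.1, x.2, rfl⟩

variable (A : Type*) [NormedRing A]

/-- The inductive limit topology on `GL_∞(A)`: a set is open if and only if its intersection with
each `GL_n(A)` is. -/
instance GLInf.topologicalSpace : TopologicalSpace (GLInf A) :=
  ⨆ n : ℕ, TopologicalSpace.coinduced (GLInf.of (R := A) n) inferInstance

variable {A}

theorem GLInf.continuous_of (n : ℕ) : Continuous (GLInf.of (R := A) n) :=
  continuous_iff_coinduced_le.2
    (le_iSup (fun n : ℕ => TopologicalSpace.coinduced (GLInf.of (R := A) n) inferInstance) n)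

theorem continuous_padOne (k n : ℕ) :
    Continuous (padOne (R := A) (k := k) n) := by
  refine continuous_matrix fun i j => ?_
  by_cases h : i.1 < k ∧ j.1 < k
  · simp only [padOne, Matrix.of_apply, h, dif_pos, and_self]
    exact continuous_id.matrix_elem _ _
  · simp only [padOne, Matrix.of_apply, h, dif_neg, not_false_eq_true]
    exact continuous_const

theorem continuous_glPad {k n : ℕ} (h : k ≤ n) : Continuous (glPad (R := A) k n h) :=
  Continuous.units_map _ (continuous_padOne k n)

theorem GLInf.continuous_mul_left (g : GLInf A) : Continuous fun x : GLInf A => g * x := by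
  obtain ⟨k, g, rfl⟩ := GLInf.exists_of g
  refine continuous_iSup_dom.2 fun n => continuous_coinduced_dom.2 ?_
  have : (fun x : GLInf A => GLInf.of k g * x) ∘ GLInf.of n =
      fun x => GLInf.of (max k n) (glPad k _ (le_max_left k n) g * glPad n _ (le_max_right k n) x) := by
    funext x
    simp [GLInf.of_glPad]
  rw [this]
  exact (GLInf.continuous_of _).comp (continuous_const.mul (continuous_glPad _))

variable (A)

/-- `GL_∞^0(A)`, the connected component of `1` in `GL_∞(A)`, as a subgroup. -/
def GLInfZero : Subgroup (GLInf A) where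
  carrier := connectedComponent (1 : GLInf A)
  one_mem' := mem_connectedComponent
  mul_mem' := by
    intro x y hx hy
    have h := (isConnected_connectedComponent (x := (1 : GLInf A))).image _
      (GLInf.continuous_mul_left x).continuousOn
    have h1 : x ∈ (fun z => x * z) '' connectedComponent (1 : GLInf A) :=
      ⟨1, mem_connectedComponent, mul_one x⟩
    have h2 := h.isPreconnected.subset_connectedComponent h1
    rw [← connectedComponent_eq hx] at h2
    exact h2 ⟨y, hy, rfl⟩
  inv_mem' := by
    intro x hx
    have h := (isConnected_connectedComponent (x := (1 : GLInf A))).image _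
      (GLInf.continuous_mul_left x⁻¹).continuousOn
    have h1 : (1 : GLInf A) ∈ (fun z => x⁻¹ * z) '' connectedComponent (1 : GLInf A) :=
      ⟨x, hx, inv_mul_cancel x⟩
    exact h.isPreconnected.subset_connectedComponent h1 ⟨1, mem_connectedComponent, mul_one _⟩

end GLInf

/-! ### Traces -/

section Trace

/-- A trace on `A`: a continuous linear form `τ : A → ℂ` with `τ(yx) = τ(xy)`. -/
structure BTrace (A : Type*) [NormedRing A] [NormedAlgebra ℂ A] where
  toCLM : A →L[ℂ] ℂ
  tracial : ∀ x y : A, toCLM (y * x) = toCLM (x * y)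

variable {A : Type*} [NormedRing A] [NormedAlgebra ℂ A]

/-- The extension of `τ` to matrices, `x ↦ ∑ τ(x_{j,j})`. -/
def BTrace.mat (τ : BTrace A) {n : ℕ} (x : Matrix (Fin n) (Fin n) A) : ℂ :=
  ∑ j, τ.toCLM (x j j)

theorem BTrace.mat_mul_comm (τ : BTrace A) {k l : ℕ} (a : Matrix (Fin k) (Fin l) A)
    (b : Matrix (Fin l) (Fin k) A) : τ.mat (a * b) = τ.mat (b * a) := by
  simp only [BTrace.mat, Matrix.mul_apply, map_sum]
  rw [Finset.sum_comm]
  exact Finset.sum_congr rfl fun i _ => Finset.sum_congr rfl fun j _ => τ.tracial _ _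

theorem BTrace.mat_blockSum (τ : BTrace A) {k l : ℕ} (x : Matrix (Fin k) (Fin k) A)
    (y : Matrix (Fin l) (Fin l) A) : τ.mat (blockSum x y) = τ.mat x + τ.mat y := by
  simp [BTrace.mat, blockSum, Fin.sum_univ_add]

/-- The homomorphism `K_0(A) → ℂ`, `[e] ↦ τ(e)`, induced by a trace `τ`. -/
def BTrace.onKZero (τ : BTrace A) : KZero A →+ ℂ :=
  Algebra.GrothendieckAddGroup.lift
    { toFun := Quotient.lift (fun e : Idem A => τ.mat e.mat) (by
        intro e f h
        obtain ⟨a, b, h1, h2⟩ := (Idem.equivalent_iff e f).1 h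
        rw [← h1, ← h2, τ.mat_mul_comm])
      map_zero' := by
        change τ.mat (Idem.zero (R := A)).mat = 0
        exact Finset.sum_eq_zero fun j _ => j.elim0
      map_add' := by
        rintro ⟨e⟩ ⟨f⟩
        change τ.mat (Idem.sum e f).mat = τ.mat e.mat + τ.mat f.mat
        exact τ.mat_blockSum e.mat f.mat }

/-- The identity `ℂ → ℂ`, as a trace. -/
def idTrace : BTrace ℂ where
  toCLM := ContinuousLinearMap.id ℂ ℂ
  tracial x y := mul_comm y x

end Trace

/-! ### Paths and the determinant -/

section Det

variable {A : Type*} [NormedRing A] [NormedAlgebra ℂ A]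

/-- A matrix-valued map is piecewise differentiable (continuous and piecewise `C¹`) on `[a, b]`:
for some subdivision of `[a, b]`, its entries are `C¹` on each closed subinterval. -/
def PiecewiseDiff {n : ℕ} (ξ : ℝ → Matrix (Fin n) (Fin n) A) (a b : ℝ) : Prop :=
  ∃ (N : ℕ) (t : ℕ → ℝ), Monotone t ∧ t 0 = a ∧ t N = b ∧
    ∀ m < N, ∀ i j, ContDiffOn ℝ 1 (fun s => ξ s i j) (Set.Icc (t m) (t (m + 1)))

variable (A)

/-- A piecewise differentiable path `ξ : [a, b] → GL_∞^0(A)`. By compactness its image lies in some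
`GL_n(A)`. The values of `toFun` outside `[a, b]` are irrelevant. -/
structure GLPath where
  n : ℕ
  a : ℝ
  b : ℝ
  le : a ≤ b
  toFun : ℝ → (Matrix (Fin n) (Fin n) A)ˣ
  piecewiseDiff : PiecewiseDiff (fun s => (toFun s : Matrix (Fin n) (Fin n) A)) a b
  mem : ∀ s ∈ Set.Icc a b, GLInf.of n (toFun s) ∈ GLInfZero A

variable {A}

/-- `ξ` has origin `x` and extremity `y`. -/
def GLPath.Joins (ξ : GLPath A) (x y : GLInf A) : Prop :=
  GLInf.of ξ.n (ξ.toFun ξ.a) = x ∧ GLInf.of ξ.n (ξ.toFun ξ.b) = y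

/-- The (entrywise) derivative of `ξ`. -/
def GLPath.dot (ξ : GLPath A) (s : ℝ) : Matrix (Fin ξ.n) (Fin ξ.n) A :=
  Matrix.of fun i j => deriv (fun r => (ξ.toFun r : Matrix (Fin ξ.n) (Fin ξ.n) A) i j) s

/-- `(2πi)⁻¹ ∫_a^b τ(ξ'(s) ξ(s)⁻¹) ds`. -/
def deltaTilde (τ : BTrace A) (ξ : GLPath A) : ℂ :=
  (1 / (2 * Real.pi * Complex.I)) *
    ∫ s in ξ.a..ξ.b, τ.mat (ξ.dot s * (↑(ξ.toFun s)⁻¹ : Matrix (Fin ξ.n) (Fin ξ.n) A))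

open Classical in
/-- `Δ_τ(x)`: the class modulo `τ(K_0(A))` of `deltaTilde τ ξ`, for a path `ξ` in `GL_∞^0(A)`
from `1` to `x`. -/
def delta (τ : BTrace A) (x : GLInfZero A) : ℂ ⧸ τ.onKZero.range :=
  if h : ∃ ξ : GLPath A, ξ.Joins 1 x then ((deltaTilde τ h.choose : ℂ) : ℂ ⧸ τ.onKZero.range)
  else 0

/-- `z ↦ exp(2πi z)` as a homomorphism from `(ℂ, +)` to `ℂˣ`. -/
def expTwoPiI : ℂ →+ Additive ℂˣ where
  toFun z := Additive.ofMul (Units.mk0 (Complex.exp (2 * Real.pi * Complex.I * z))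
    (Complex.exp_ne_zero _))
  map_zero' := by
    apply Additive.toMul.injective
    ext
    simp
  map_add' z w := by
    apply Additive.toMul.injective
    ext
    simp [mul_add, Complex.exp_add]

/-- The subgroup `ℤ` of `(ℂ, +)`. -/
def intSubgroup : AddSubgroup ℂ := (Int.castAddHom ℂ).range

/-- When `τ(K_0(A)) = ℤ`, the map `exp(2πi Δ_τ) : GL_∞^0(A) → ℂˣ`. -/
def expDelta (τ : BTrace A) (h : τ.onKZero.range = intSubgroup) (x : GLInfZero A) : ℂˣ :=
  Additive.toMul (QuotientAddGroup.lift τ.onKZero.range expTwoPiI (by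
    rw [h]
    rintro _ ⟨m, rfl⟩
    apply Additive.toMul.injective
    ext
    change Complex.exp (2 * Real.pi * Complex.I * (m : ℂ)) = 1
    rw [mul_comm]
    exact Complex.exp_int_mul_two_pi_mul_I m) (delta τ x))

/-- `e^y ∈ GL_n(A)`, for `y ∈ M_n(A)`. -/
def expGL [CompleteSpace A] {n : ℕ} (y : Matrix (Fin n) (Fin n) A) :
    (Matrix (Fin n) (Fin n) A)ˣ :=
  IsUnit.unit (a := NormedSpace.exp y) (by
    let _ : NormedAlgebra ℚ A := NormedAlgebra.restrictScalars ℚ ℂ A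
    exact Matrix.isUnit_exp y)

end Det

end BanachDet

end

open BanachDet

/-! Everything rests on one fact: for a loop `f` in the invertible group of a Banach algebra `M`
with trace `T`, the number `(2πi)⁻¹ ∫ T(f' f⁻¹)` lies in the range of `T` on `K_0(M)`. This is
`logIntegral_loop_mem_range`. Two paths with the same ends in `GL_∞(A)` become, after padding to a
common size, paths `f`, `g` in one `GL_n(A)`; then `f g⁻¹` is a loop, and since `T` is tracial its
logarithmic integral is the difference of those of `f` and `g`. This gives independence of the path
modulo the range, for any trace. The hypothesis that the range is `ℤ` serves only to make `exp(2πi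
·)` pass to the quotient.

The fact on loops is proved in the manner of Atiyah and Bott. A loop is uniformly close to a Laurent
loop `z^{-N} p(z)` with `z = e^{2πis}`. Loops that are close have the same logarithmic integral:
their quotient is a loop near `1`, the geometric series expands `T(h' h⁻¹)` into terms `T(h'
(1-h)^k)`, and each of these is an exact derivative by traciality. The factor `z^{-N}` contributes
`-N T(1)`. The degree of `p` is lowered one step at a time by replacing `a₀ + z q(z)` with the 2×2
matrix `(a₀ q; -z 1)`, which has the same traced logarithmic derivative. For a pencil `B + zC` the
contour integral `(2πi)⁻¹ ∮ C (B + zC)⁻¹ dz` is an idempotent by the resolvent identity, so its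
trace is in the range. Idempotent matrices over `M_n(A)` are idempotent matrices over `A`, so these
passages to matrices do not enlarge the range.

Paths exist because the elements of `GL_∞(A)` reachable from `1` by a `C¹` path form a clopen set.
Multiplicativity comes from the pointwise product of paths, and the value at `e^y` from the path `s
↦ e^{sy}`, whose traced logarithmic derivative is constant. Over `ℂ` the trace of an idempotent is
its rank, and diagonal matrices and transvections, which are exponentials, generate `GL_n(ℂ)`. -/

noncomputable section

namespace BanachDet

/-! ### Matrices over a Banach algebra as a Banach algebra -/

section MatAlg

/-- The Banach algebra `M_n(A)`, with the `L^∞` operator norm. -/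
def MatAlg (n : ℕ) (A : Type*) : Type _ := Matrix (Fin n) (Fin n) A

variable {A : Type*} [NormedRing A] {n : ℕ}

instance : NormedRing (MatAlg n A) :=
  (Matrix.linftyOpNormedRing : NormedRing (Matrix (Fin n) (Fin n) A))

open scoped Matrix.Norms.Operator in
instance [NormedAlgebra ℂ A] : NormedAlgebra ℂ (MatAlg n A) :=
  (Matrix.linftyOpNormedAlgebra : NormedAlgebra ℂ (Matrix (Fin n) (Fin n) A))

instance [CompleteSpace A] : CompleteSpace (MatAlg n A) :=
  (inferInstance : CompleteSpace (Matrix (Fin n) (Fin n) A))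

theorem MatAlg.continuous_entry (i j : Fin n) : Continuous fun x : MatAlg n A => x i j :=
  (continuous_id.matrix_elem i j : Continuous fun x : Matrix (Fin n) (Fin n) A => x i j)

theorem MatAlg.continuous_single (i j : Fin n) :
    Continuous fun x : A => (Matrix.single i j x : MatAlg n A) :=
  (continuous_matrix fun k l => by
    simp only [Matrix.single_apply]
    split_ifs
    exacts [continuous_id, continuous_const] :
    Continuous fun x : A => (Matrix.single i j x : Matrix (Fin n) (Fin n) A))

variable [NormedAlgebra ℂ A]

/-- The coordinate map `x ↦ x_{i,j}`. -/
def MatAlg.entryCLM (i j : Fin n) : MatAlg n A →L[ℂ] A where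
  toFun x := x i j
  map_add' _ _ := rfl
  map_smul' _ _ := rfl
  cont := MatAlg.continuous_entry i j

/-- The map sending `x` to the matrix with `(i,j)` entry `x` and other entries zero. -/
def MatAlg.singleCLM (i j : Fin n) : A →L[ℂ] MatAlg n A where
  toFun x := (Matrix.single i j x : Matrix (Fin n) (Fin n) A)
  map_add' x y := Matrix.single_add i j x y
  map_smul' c x := (Matrix.smul_single c i j x).symm
  cont := MatAlg.continuous_single i j

theorem MatAlg.eq_sum_single (x : MatAlg n A) :
    x = ∑ i, ∑ j, MatAlg.singleCLM i j (x i j) :=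
  Matrix.matrix_eq_sum_single (m := Fin n) (n := Fin n) (α := A) x

/-- The extension of a trace to `M_n(A)`, as a trace on a Banach algebra. -/
def BTrace.toMat (τ : BTrace A) (n : ℕ) : BTrace (MatAlg n A) where
  toCLM := ∑ j, τ.toCLM.comp (MatAlg.entryCLM j j)
  tracial x y := by
    have := τ.mat_mul_comm (k := n) (l := n) y x
    simpa [BTrace.mat] using! this

theorem BTrace.toMat_apply (τ : BTrace A) (x : MatAlg n A) :
    (τ.toMat n).toCLM x = τ.mat (n := n) x := by
  simp only [BTrace.toMat, BTrace.mat, sum_apply]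
  rfl

theorem MatAlg.hasDerivAt_of_entry {f : ℂ → MatAlg n A} {f' : MatAlg n A} {x : ℂ}
    (h : ∀ i j, HasDerivAt (fun s => f s i j) (f' i j) x) : HasDerivAt f f' x := by
  have h1 : HasDerivAt (fun s => ∑ i, ∑ j, MatAlg.singleCLM (A := A) (n := n) i j (f s i j))
      (∑ i, ∑ j, MatAlg.singleCLM i j (f' i j)) x :=
    HasDerivAt.fun_sum fun i _ => HasDerivAt.fun_sum fun j _ =>
      (MatAlg.singleCLM (A := A) (n := n) i j).hasFDerivAt.comp_hasDerivAt x (h i j)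
  simpa only [← MatAlg.eq_sum_single] using h1

/-- Paths are differentiable entry by entry by definition, while the analysis below uses the
operator norm. A matrix is a finite sum of continuous linear images of its entries, so the two
notions agree. -/
theorem MatAlg.contDiffOn_of_entry {f : ℝ → MatAlg n A} {s : Set ℝ} {k : ℕ∞}
    (h : ∀ i j, ContDiffOn ℝ k (fun s => f s i j) s) : ContDiffOn ℝ k f s := by
  have h1 : ContDiffOn ℝ k
      (fun s => ∑ i, ∑ j, MatAlg.singleCLM (A := A) (n := n) i j (f s i j)) s :=
    ContDiffOn.sum fun i _ => ContDiffOn.sum fun j _ =>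
      ((MatAlg.singleCLM (A := A) (n := n) i j).restrictScalars ℝ).contDiff.comp_contDiffOn (h i j)
  simpa only [← MatAlg.eq_sum_single] using h1

theorem MatAlg.contDiffOn_entry {f : ℝ → MatAlg n A} {s : Set ℝ} {k : ℕ∞}
    (h : ContDiffOn ℝ k f s) (i j : Fin n) : ContDiffOn ℝ k (fun s => f s i j) s :=
  ((MatAlg.entryCLM (A := A) (n := n) i j).restrictScalars ℝ).contDiff.comp_contDiffOn h

end MatAlg

/-! ### The range of a trace on `K_0` -/

section Range

variable {A : Type*} [NormedRing A] [NormedAlgebra ℂ A]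

/-- The class of an idempotent in `K_0(A)`. -/
def Idem.toKZero (e : Idem A) : KZero A :=
  Algebra.GrothendieckAddGroup.of (Quotient.mk _ e : IdemClass A)

theorem BTrace.onKZero_toKZero (τ : BTrace A) (e : Idem A) :
    τ.onKZero e.toKZero = τ.mat e.mat := by
  rw [BTrace.onKZero, Idem.toKZero]
  exact DFunLike.congr_fun (Algebra.GrothendieckAddGroup.lift.symm_apply_apply
    (_ : IdemClass A →+ ℂ)) (Quotient.mk _ e : IdemClass A)

theorem BTrace.mat_mem_range (τ : BTrace A) (e : Idem A) : τ.mat e.mat ∈ τ.onKZero.range :=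
  ⟨e.toKZero, τ.onKZero_toKZero e⟩

/-- Every element of a Grothendieck group is a difference of two classes, so a subgroup has only to
be tested on idempotents. -/
theorem BTrace.range_onKZero_le (τ : BTrace A) {S : AddSubgroup ℂ}
    (h : ∀ e : Idem A, τ.mat e.mat ∈ S) : τ.onKZero.range ≤ S := by
  rintro _ ⟨x, rfl⟩
  rw [BTrace.onKZero, Algebra.GrothendieckAddGroup.lift_apply]
  refine S.sub_mem ?_ ?_
  · exact Quotient.inductionOn (motive := fun q : IdemClass A => Quotient.lift (fun e : Idem A => τ.mat e.mat) _ q ∈ S) _ h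
  · exact Quotient.inductionOn (motive := fun q : IdemClass A => Quotient.lift (fun e : Idem A => τ.mat e.mat) _ q ∈ S) _ h

/-- An idempotent matrix over `M_n(A)` as an idempotent matrix over `A`. -/
def Idem.flatten {n : ℕ} (e : Idem (MatAlg n A)) : Idem A where
  size := e.size * n
  mat := (Matrix.comp _ _ _ _ A e.mat).submatrix finProdFinEquiv.symm finProdFinEquiv.symm
  idem := by
    have h := congrArg (Matrix.compRingEquiv (Fin e.size) (Fin n) A) e.idem
    have h2 := ((Matrix.compRingEquiv (Fin e.size) (Fin n) A).map_mul e.mat e.mat).symm.trans h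
    rw [Matrix.submatrix_mul_equiv]
    exact congrArg (fun x => Matrix.submatrix x finProdFinEquiv.symm finProdFinEquiv.symm) h2

theorem BTrace.mat_flatten (τ : BTrace A) {n : ℕ} (e : Idem (MatAlg n A)) :
    τ.mat e.flatten.mat = (τ.toMat n).mat e.mat := by
  rw [BTrace.mat, BTrace.mat]
  simp only [BTrace.toMat_apply, BTrace.mat]
  rw [← Fintype.sum_prod_type']
  exact (Equiv.sum_comp finProdFinEquiv _).symm.trans
    (Finset.sum_congr rfl fun p _ => by
      change τ.toCLM (e.mat _ _ _ _) = _
      rw [Equiv.symm_apply_apply])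

/-- Flattening blocks preserves the trace. This is what permits replacing `A` by a matrix algebra
over it, both for `GL_n(A)` and in the linearization of polynomials. -/
theorem BTrace.range_toMat_le (τ : BTrace A) (n : ℕ) :
    (τ.toMat n).onKZero.range ≤ τ.onKZero.range :=
  BTrace.range_onKZero_le _ fun e => τ.mat_flatten e ▸ τ.mat_mem_range e.flatten

theorem BTrace.apply_mem_range (τ : BTrace A) {p : A} (hp : p * p = p) :
    τ.toCLM p ∈ τ.onKZero.range := by
  have := τ.mat_mem_range ⟨1, Matrix.of fun _ _ => p, by ext i j; simp [Matrix.mul_apply, hp]⟩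
  simpa [BTrace.mat] using this

end Range

/-! ### The spectral idempotent of a linear pencil -/

section Pencil

open MeasureTheory Metric Complex

theorem _root_.ContinuousLinearMap.circleIntegral_comp_comm {E F : Type*} [NormedAddCommGroup E]
    [NormedSpace ℂ E] [CompleteSpace E] [NormedAddCommGroup F] [NormedSpace ℂ F] [CompleteSpace F]
    (L : E →L[ℂ] F) {f : ℂ → E} {c : ℂ} {R : ℝ} (hf : CircleIntegrable f c R) :
    (∮ z in C(c, R), L (f z)) = L (∮ z in C(c, R), f z) := by
  rw [circleIntegral, circleIntegral, ← L.intervalIntegral_comp_comm hf.out]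
  simp only [map_smul]

theorem continuous_comp_circleMap {E : Type*} [TopologicalSpace E]
    {F : ℂ → ℂ → E} {c c' : ℂ} {R R' : ℝ} (hR : 0 ≤ R) (hR' : 0 ≤ R')
    (hF : ContinuousOn (fun p : ℂ × ℂ => F p.1 p.2) (sphere c R ×ˢ sphere c' R')) :
    Continuous fun p : ℝ × ℝ => F (circleMap c R p.1) (circleMap c' R' p.2) :=
  hF.comp_continuous (f := fun p : ℝ × ℝ => (circleMap c R p.1, circleMap c' R' p.2))
    (by fun_prop) fun _ => ⟨circleMap_mem_sphere _ hR _, circleMap_mem_sphere _ hR' _⟩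

theorem circleIntegral_swap {E : Type*} [NormedAddCommGroup E] [NormedSpace ℂ E]
    {F : ℂ → ℂ → E} {c c' : ℂ} {R R' : ℝ} (hR : 0 ≤ R) (hR' : 0 ≤ R')
    (hF : ContinuousOn (fun p : ℂ × ℂ => F p.1 p.2) (sphere c R ×ˢ sphere c' R')) :
    (∮ z in C(c, R), ∮ w in C(c', R'), F z w) = ∮ w in C(c', R'), ∮ z in C(c, R), F z w := by
  simp only [circleIntegral, ← intervalIntegral.integral_smul]
  rw [intervalIntegral_intervalIntegral_swap]
  · refine intervalIntegral.integral_congr fun t _ => intervalIntegral.integral_congr fun s _ => ?_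
    exact smul_comm _ _ _
  · have h1 := continuous_comp_circleMap hR hR' hF
    have h2 : Continuous fun p : ℝ × ℝ => deriv (circleMap c R) p.1 •
        deriv (circleMap c' R') p.2 • F (circleMap c R p.1) (circleMap c' R' p.2) := by
      simp only [deriv_circleMap]
      exact (((continuous_circleMap 0 R).comp continuous_fst).mul continuous_const).smul
        ((((continuous_circleMap 0 R').comp continuous_snd).mul continuous_const).smul h1)
    exact (h2.continuousOn.integrableOn_compact (isCompact_uIcc.prod isCompact_uIcc)).mono_set
      (Set.prod_mono Set.uIoc_subset_uIcc Set.uIoc_subset_uIcc)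

theorem circleIntegrable_circleIntegral {E : Type*} [NormedAddCommGroup E] [NormedSpace ℂ E]
    {F : ℂ → ℂ → E} {c c' : ℂ} {R R' : ℝ} (hR : 0 ≤ R) (hR' : 0 ≤ R')
    (hF : ContinuousOn (fun p : ℂ × ℂ => F p.1 p.2) (sphere c R ×ˢ sphere c' R')) :
    CircleIntegrable (fun z => ∮ w in C(c', R'), F z w) c R := by
  refine Continuous.intervalIntegrable ?_ _ _
  simp only [circleIntegral]
  refine intervalIntegral.continuous_parametric_intervalIntegral_of_continuous' ?_ _ _
  simp only [deriv_circleMap]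
  exact (((continuous_circleMap 0 R').comp continuous_snd).mul continuous_const).smul
    (continuous_comp_circleMap hR hR' hF)

variable {M : Type*} [NormedRing M] [NormedAlgebra ℂ M] [CompleteSpace M]

/-- The contour integral of a pseudo-resolvent is idempotent. -/
theorem circleIntegral_pseudoResolvent_idem {R : ℂ → M} {r : ℝ} (hr : 1 < r)
    (hd : ∀ z ∈ closedBall (0 : ℂ) r \ ball 0 1, DifferentiableAt ℂ R z)
    (hR : ∀ z ∈ closedBall (0 : ℂ) r \ ball 0 1, ∀ w ∈ closedBall (0 : ℂ) r \ ball 0 1,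
      (w - z) • (R z * R w) = R z - R w) :
    (∮ z in C(0, 1), R z) * (∮ z in C(0, 1), R z) = (2 * Real.pi * I) • ∮ z in C(0, 1), R z := by
  have hc : ContinuousOn R (closedBall (0 : ℂ) r \ ball 0 1) := fun z hz =>
    (hd z hz).continuousAt.continuousWithinAt
  have hs1 : sphere (0 : ℂ) 1 ⊆ closedBall (0 : ℂ) r \ ball 0 1 := fun z hz => by
    simp at hz ⊢; constructor <;> linarith
  have hsr : sphere (0 : ℂ) r ⊆ closedBall (0 : ℂ) r \ ball 0 1 := fun z hz => by
    simp at hz ⊢; constructor <;> linarith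
  have hr0 : 0 ≤ r := by linarith
  have i1 : CircleIntegrable R 0 1 := (hc.mono hs1).circleIntegrable zero_le_one
  have ir : CircleIntegrable R 0 r := (hc.mono hsr).circleIntegrable hr0
  -- Cauchy on the annulus: one of the two factors is moved to the larger circle, so that `w - z`
  -- never vanishes in the double integral.
  have hP : (∮ z in C(0, r), R z) = ∮ z in C(0, 1), R z :=
    circleIntegral_eq_of_differentiable_on_annulus_off_countable one_pos hr.le
      Set.countable_empty hc fun z hz => hd z ⟨ball_subset_closedBall hz.1.1,
        fun h => hz.1.2 (ball_subset_closedBall h)⟩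
  have hne : ∀ z ∈ sphere (0 : ℂ) 1, ∀ w ∈ sphere (0 : ℂ) r, w - z ≠ 0 := by
    intro z hz w hw h
    rw [sub_eq_zero] at h
    simp at hz hw
    rw [h] at hw
    linarith
  have hF : ContinuousOn (fun p : ℂ × ℂ => (p.2 - p.1)⁻¹ • R p.1)
      (sphere (0 : ℂ) 1 ×ˢ sphere (0 : ℂ) r) := by
    refine ContinuousOn.smul (ContinuousOn.inv₀ (by fun_prop) fun p hp => hne _ hp.1 _ hp.2) ?_
    exact (hc.mono hs1).comp continuousOn_fst fun p hp => hp.1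
  have hG : ContinuousOn (fun p : ℂ × ℂ => (p.2 - p.1)⁻¹ • R p.2)
      (sphere (0 : ℂ) 1 ×ˢ sphere (0 : ℂ) r) := by
    refine ContinuousOn.smul (ContinuousOn.inv₀ (by fun_prop) fun p hp => hne _ hp.1 _ hp.2) ?_
    exact (hc.mono hsr).comp continuousOn_snd fun p hp => hp.2
  have hcw : ∀ z ∈ sphere (0 : ℂ) 1, ContinuousOn (fun w => (w - z)⁻¹) (sphere (0 : ℂ) r) :=
    fun z hz => ContinuousOn.inv₀ (by fun_prop) fun w hw => hne _ hz _ hw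
  -- Each `z` lies inside the circle of radius `r`, so the inner integral of `(w - z)⁻¹` is `2πi`.
  have e1 : (∮ z in C(0, 1), ∮ w in C(0, r), (w - z)⁻¹ • R z)
      = (2 * Real.pi * I) • ∮ z in C(0, 1), R z := by
    rw [← circleIntegral.integral_smul]
    refine circleIntegral.integral_congr zero_le_one fun z hz => ?_
    rw [circleIntegral.integral_smul_const, circleIntegral.integral_sub_inv_of_mem_ball]
    simp at hz ⊢
    linarith
  -- After exchanging the integrals, `w` lies outside the closed unit disc, where `z ↦ (w - z)⁻¹` is
  -- holomorphic: the inner integral vanishes.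
  have e2 : (∮ z in C(0, 1), ∮ w in C(0, r), (w - z)⁻¹ • R w) = 0 := by
    rw [circleIntegral_swap zero_le_one hr0 hG]
    refine (circleIntegral.integral_congr hr0 (g := fun _ => 0) fun w hw => ?_).trans (by simp [circleIntegral])
    simp only
    rw [circleIntegral.integral_smul_const,
      circleIntegral_eq_zero_of_differentiable_on_off_countable zero_le_one Set.countable_empty,
      zero_smul]
    · refine ContinuousOn.inv₀ (by fun_prop) fun z hz h => ?_
      rw [sub_eq_zero] at h
      simp at hz hw
      rw [h] at hw
      linarith
    · refine fun z hz => DifferentiableAt.inv (by fun_prop) fun h => ?_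
      rw [sub_eq_zero] at h
      simp at hz hw
      rw [h] at hw
      linarith
  calc (∮ z in C(0, 1), R z) * (∮ z in C(0, 1), R z)
      = ∮ z in C(0, 1), R z * ∮ w in C(0, r), R w := by
        rw [hP]
        exact (((ContinuousLinearMap.mul ℂ M).flip _).circleIntegral_comp_comm i1).symm
    _ = ∮ z in C(0, 1), ((∮ w in C(0, r), (w - z)⁻¹ • R z) - ∮ w in C(0, r), (w - z)⁻¹ • R w) := by
        refine circleIntegral.integral_congr zero_le_one fun z hz => ?_
        rw [← circleIntegral.integral_sub]
        · rw [← ContinuousLinearMap.mul_apply' ℂ M, ← ((ContinuousLinearMap.mul ℂ M) _).circleIntegral_comp_comm ir]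
          refine circleIntegral.integral_congr hr0 fun w hw => ?_
          simp only [ContinuousLinearMap.mul_apply']
          rw [← smul_sub, ← hR z (hs1 hz) w (hsr hw), inv_smul_smul₀ (hne z hz w hw)]
        · exact ((hcw z hz).smul continuousOn_const).circleIntegrable hr0
        · exact ((hcw z hz).smul (hc.mono hsr)).circleIntegrable hr0
    _ = (∮ z in C(0, 1), ∮ w in C(0, r), (w - z)⁻¹ • R z) -
          ∮ z in C(0, 1), ∮ w in C(0, r), (w - z)⁻¹ • R w := by
        refine circleIntegral.integral_sub ?_ ?_
        · exact circleIntegrable_circleIntegral zero_le_one hr0 hF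
        · exact circleIntegrable_circleIntegral zero_le_one hr0 hG
    _ = _ := by rw [e1, e2, sub_zero]

/-- The logarithmic derivative of a linear pencil which is invertible on the unit circle integrates
to the trace of an idempotent. -/
theorem circleIntegral_pencil_mem_range (T : BTrace M) (B C : M)
    (h : ∀ z : ℂ, ‖z‖ = 1 → IsUnit (B + z • C)) :
    (2 * Real.pi * I : ℂ)⁻¹ * (∮ z in C(0, 1), T.toCLM (C * Ring.inverse (B + z • C)))
      ∈ T.onKZero.range := by
  have hcont : Continuous fun z : ℂ => B + z • C := by fun_prop
  -- Invertibility is an open condition and the circle is compact, so the pencil stays invertible on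
  -- an annulus `1 ≤ ‖z‖ ≤ 1 + δ`.
  obtain ⟨δ, hδ, hδU⟩ := (isCompact_sphere (0 : ℂ) 1).exists_cthickening_subset_open
    (Units.isOpen.preimage hcont) (fun z hz => h z (by simpa using hz))
  have hU : ∀ z ∈ closedBall (0 : ℂ) (1 + δ) \ ball 0 1, IsUnit (B + z • C) := by
    intro z hz
    refine hδU ?_
    simp at hz
    have hz0 : (0 : ℝ) < ‖z‖ := by linarith
    -- The radial projection `z / ‖z‖` is a point of the circle at distance `‖z‖ - 1 ≤ δ`.
    refine Metric.mem_cthickening_of_dist_le z ((‖z‖⁻¹ : ℝ) • z) δ _ ?_ ?_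
    · simp [hz0.ne']
    · have : z - (‖z‖⁻¹ : ℝ) • z = (1 - ‖z‖⁻¹ : ℝ) • z := by rw [sub_smul, one_smul]
      rw [dist_eq_norm, this, norm_smul, Real.norm_of_nonneg
        (sub_nonneg.2 (inv_le_one_of_one_le₀ hz.2)), sub_mul, inv_mul_cancel₀ hz0.ne']
      linarith
  set R : ℂ → M := fun z => C * Ring.inverse (B + z • C) with hRdef
  have hd : ∀ z ∈ closedBall (0 : ℂ) (1 + δ) \ ball 0 1, DifferentiableAt ℂ R z := by
    intro z hz
    have h1 : DifferentiableAt ℂ (Ring.inverse ∘ fun z : ℂ => B + z • C) z :=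
      (differentiableAt_inverse (𝕜 := ℂ) (hU z hz)).comp z (by fun_prop)
    exact (differentiableAt_const C).mul h1
  have hR : ∀ z ∈ closedBall (0 : ℂ) (1 + δ) \ ball 0 1,
      ∀ w ∈ closedBall (0 : ℂ) (1 + δ) \ ball 0 1, (w - z) • (R z * R w) = R z - R w := by
    intro z hz w hw
    obtain ⟨u, hu⟩ := hU z hz
    obtain ⟨v, hv⟩ := hU w hw
    -- The resolvent identity for `C (B + zC)⁻¹` follows by writing the inner `(w - z) C` as a
    -- difference of two values of the pencil. Neither `B` nor `C` has to be invertible.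
    have h1 : (w - z) • C = (v : M) - u := by rw [hu, hv, sub_smul]; abel
    simp only [hRdef, ← hu, ← hv, Ring.inverse_unit]
    calc (w - z) • (C * ↑u⁻¹ * (C * ↑v⁻¹)) = C * ↑u⁻¹ * ((w - z) • C) * ↑v⁻¹ := by
          simp only [mul_smul_comm, smul_mul_assoc, mul_assoc]
      _ = C * ↑u⁻¹ - C * ↑v⁻¹ := by
          rw [h1, mul_sub, sub_mul]
          simp [mul_assoc]
  have hidem := circleIntegral_pseudoResolvent_idem (r := 1 + δ) (by linarith) hd hR
  have hint : CircleIntegrable R 0 1 := by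
    refine ContinuousOn.circleIntegrable zero_le_one fun z hz =>
      (hd z ?_).continuousAt.continuousWithinAt
    simp at hz ⊢
    constructor <;> linarith
  have := T.apply_mem_range (p := (2 * Real.pi * I : ℂ)⁻¹ • ∮ z in C(0, 1), R z) (by
    rw [smul_mul_smul_comm, hidem, smul_smul, mul_assoc, inv_mul_cancel₀ two_pi_I_ne_zero, mul_one])
  rwa [map_smul, smul_eq_mul, ← T.toCLM.circleIntegral_comp_comm hint] at this

end Pencil

/-! ### Polynomial loops -/

section Polynomial

open MeasureTheory Metric Complex

variable {M : Type*} [NormedRing M] [NormedAlgebra ℂ M]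

/-- The linearization step `a₀ + z q(z) ↦ (a₀ q(z); -z 1)`. -/
def linearize (a : ℕ → M) (k : ℕ) : MatAlg 2 M :=
  Matrix.of ![![if k = 0 then a 0 else 0, a (k + 1)], ![if k = 1 then -1 else 0, if k = 0 then 1 else 0]]

/-- The bound `1 ≤ d` keeps the index `1`, which carries the entry `-z`, inside the range of
summation. The pencil has degree `d` where `a₀ + z q` has degree `d + 1`. -/
theorem sum_linearize (a : ℕ → M) {d : ℕ} (hd : 1 ≤ d) (z : ℂ) :
    ∑ k ∈ Finset.range (d + 1), z ^ k • linearize a k =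
      (Matrix.of ![![a 0, ∑ k ∈ Finset.range (d + 1), z ^ k • a (k + 1)], ![-(z • 1), 1]] :
        Matrix (Fin 2) (Fin 2) M) := by
  have h : ∀ i j, (∑ k ∈ Finset.range (d + 1), z ^ k • linearize a k) i j =
      ∑ k ∈ Finset.range (d + 1), z ^ k • linearize a k i j := fun i j => by
    have := map_sum (MatAlg.entryCLM (A := M) (n := 2) i j)
      (fun k => z ^ k • linearize a k) (Finset.range (d + 1))
    exact this
  refine Matrix.ext fun i j => ?_
  rw [h]
  have h0 : 0 < d + 1 := by omega
  have h1 : 0 < d := by omega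
  fin_cases i <;> fin_cases j <;> simp [linearize, h1]

theorem hasDerivAt_sum_pow_smul (a : ℕ → M) (d : ℕ) (z : ℂ) :
    HasDerivAt (fun z : ℂ => ∑ k ∈ Finset.range (d + 1), z ^ k • a k)
      (deriv (fun z : ℂ => ∑ k ∈ Finset.range (d + 1), z ^ k • a k) z) z :=
  DifferentiableAt.hasDerivAt (by fun_prop)

/-- The linearization `(a₀ q; -z 1)` of an invertible `a₀ + z q` is invertible. -/
theorem exists_unit_linearize (a₀ q : M) (z : ℂ) (u : Mˣ) (hu : (u : M) = a₀ + z • q) :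
    ∃ v : (MatAlg 2 M)ˣ,
      (v : MatAlg 2 M) = (Matrix.of ![![a₀, q], ![-(z • 1), 1]] : Matrix (Fin 2) (Fin 2) M) ∧
      (↑v⁻¹ : MatAlg 2 M) = (Matrix.of ![![(↑u⁻¹ : M), -(↑u⁻¹ * q)],
        ![z • (↑u⁻¹ : M), 1 - z • (↑u⁻¹ * q)]] : Matrix (Fin 2) (Fin 2) M) := by
  -- The matrix factors as `(1 q; 0 1) (u 0; 0 1) (1 0; -z 1)`; the announced inverse is the product
  -- of the three inverses.
  have ha : a₀ = u - z • q := by rw [hu]; abel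
  subst ha
  have h1 : (Matrix.of ![![u - z • q, q], ![-(z • 1), 1]] : Matrix (Fin 2) (Fin 2) M) *
        Matrix.of ![![(↑u⁻¹ : M), -(↑u⁻¹ * q)], ![z • (↑u⁻¹ : M), 1 - z • (↑u⁻¹ * q)]] = 1 := by
    ext i j
    fin_cases i <;> fin_cases j <;>
      simp [Matrix.mul_apply, Fin.sum_univ_two, sub_mul, mul_sub, ← mul_assoc]
  have h2 : (Matrix.of ![![(↑u⁻¹ : M), -(↑u⁻¹ * q)], ![z • (↑u⁻¹ : M), 1 - z • (↑u⁻¹ * q)]] :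
        Matrix (Fin 2) (Fin 2) M) * Matrix.of ![![u - z • q, q], ![-(z • 1), 1]] = 1 := by
    ext i j
    fin_cases i <;> fin_cases j <;>
      simp [Matrix.mul_apply, Fin.sum_univ_two, mul_sub, smul_sub]
  exact ⟨⟨_, _, h1, h2⟩, rfl, rfl⟩

variable [CompleteSpace M]

/-- Induction on the degree, with linear pencils as the base case. The algebra is quantified inside
the statement because each step passes from `M` to `MatAlg 2 M`. -/
theorem circleIntegral_polynomial_mem_range_aux (d : ℕ) :
    ∀ {M : Type*} [NormedRing M] [NormedAlgebra ℂ M] [CompleteSpace M] (T : BTrace M) (a : ℕ → M),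
    (∀ z : ℂ, ‖z‖ = 1 → IsUnit (∑ k ∈ Finset.range (d + 2), z ^ k • a k)) →
    (2 * Real.pi * I : ℂ)⁻¹ * (∮ z in C(0, 1), T.toCLM
      (deriv (fun z : ℂ => ∑ k ∈ Finset.range (d + 2), z ^ k • a k) z *
        Ring.inverse (∑ k ∈ Finset.range (d + 2), z ^ k • a k))) ∈ T.onKZero.range := by
  induction d with
  | zero =>
    intro M _ _ _ T a h
    have e : ∀ z : ℂ, ∑ k ∈ Finset.range (0 + 2), z ^ k • a k = a 0 + z • a 1 := by
      intro z; simp [Finset.sum_range_succ]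
    simp only [e] at h ⊢
    have hd : ∀ z : ℂ, deriv (fun z : ℂ => a 0 + z • a 1) z = a 1 := fun z => by
      simpa using (((hasDerivAt_id z).smul_const (a 1)).const_add (a 0)).deriv
    simp only [hd]
    exact circleIntegral_pencil_mem_range T _ _ h
  | succ d ih =>
    intro M _ _ _ T a h
    set q : ℂ → M := fun z => ∑ k ∈ Finset.range (d + 2), z ^ k • a (k + 1) with hq
    have e : ∀ z : ℂ, ∑ k ∈ Finset.range (d + 1 + 2), z ^ k • a k = a 0 + z • q z := by
      intro z
      rw [Finset.sum_range_succ', hq, add_comm, Finset.smul_sum]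
      simp [pow_succ', mul_smul]
    have eL : ∀ z : ℂ, ∑ k ∈ Finset.range (d + 2), z ^ k • linearize a k =
        (Matrix.of ![![a 0, q z], ![-(z • 1), 1]] : Matrix (Fin 2) (Fin 2) M) := fun z =>
      sum_linearize a (d := d + 1) (by omega) z
    simp only [e] at h ⊢
    have hqd : ∀ z, HasDerivAt q (deriv q z) z := fun z =>
      hasDerivAt_sum_pow_smul (fun k => a (k + 1)) (d + 1) z
    have hd : ∀ z : ℂ, deriv (fun z : ℂ => a 0 + z • q z) z = q z + z • deriv q z := fun z => by
      have := (((hasDerivAt_id z).smul (hqd z)).const_add (a 0)).deriv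
      simpa [add_comm] using this
    have hLd : ∀ z : ℂ, deriv (fun z : ℂ => ∑ k ∈ Finset.range (d + 2), z ^ k • linearize a k) z
        = (Matrix.of ![![0, deriv q z], ![-1, 0]] : Matrix (Fin 2) (Fin 2) M) := fun z => by
      simp only [eL]
      refine (MatAlg.hasDerivAt_of_entry fun i j => ?_).deriv
      fin_cases i <;> fin_cases j
      · simpa using hasDerivAt_const z (a 0)
      · simpa using hqd z
      · simpa using ((hasDerivAt_id z).smul_const (1 : M)).fun_neg
      · simpa using hasDerivAt_const z (1 : M)
    have key : ∀ z : ℂ, ‖z‖ = 1 →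
        IsUnit (∑ k ∈ Finset.range (d + 2), z ^ k • linearize a k) ∧
        (T.toMat 2).toCLM
          (deriv (fun z : ℂ => ∑ k ∈ Finset.range (d + 2), z ^ k • linearize a k) z *
            Ring.inverse (∑ k ∈ Finset.range (d + 2), z ^ k • linearize a k)) =
        T.toCLM (deriv (fun z : ℂ => a 0 + z • q z) z * Ring.inverse (a 0 + z • q z)) := by
      intro z hz
      obtain ⟨u, hu⟩ := h z hz
      obtain ⟨v, hv, hv'⟩ := exists_unit_linearize (a 0) (q z) z u hu
      have hLv : ∑ k ∈ Finset.range (d + 2), z ^ k • linearize a k = v := (eL z).trans hv.symm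
      refine ⟨hLv ▸ v.isUnit, ?_⟩
      rw [hLd, hd, hLv, ← hu, Ring.inverse_unit, Ring.inverse_unit, BTrace.toMat_apply, hv']
      -- The diagonal of the product is `z q' u⁻¹` and `u⁻¹ q`; traciality turns the second into `q
      -- u⁻¹`, and the sum is the logarithmic derivative of `a₀ + z q`.
      have : (T.mat (n := 2) ((Matrix.of ![![0, deriv q z], ![-1, 0]] : Matrix (Fin 2) (Fin 2) M) *
        (Matrix.of ![![(↑u⁻¹ : M), -(↑u⁻¹ * q z)], ![z • (↑u⁻¹ : M), 1 - z • (↑u⁻¹ * q z)]]))) =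
        T.toCLM ((q z + z • deriv q z) * ↑u⁻¹) := by
        simp [BTrace.mat, Matrix.mul_apply, Fin.sum_univ_two, add_mul, T.tracial (q z), add_comm]
      exact this
    have := T.range_toMat_le 2 (ih (T.toMat 2) (linearize a) fun z hz => (key z hz).1)
    rwa [circleIntegral.integral_congr zero_le_one fun z hz =>
      (key z (by simpa using hz)).2] at this

/-- The logarithmic derivative of a polynomial which is invertible on the unit circle integrates
to an element of the range of the trace on `K_0`. -/
theorem circleIntegral_polynomial_mem_range (T : BTrace M) (a : ℕ → M) (d : ℕ)
    (h : ∀ z : ℂ, ‖z‖ = 1 → IsUnit (∑ k ∈ Finset.range d, z ^ k • a k)) :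
    (2 * Real.pi * I : ℂ)⁻¹ * (∮ z in C(0, 1), T.toCLM
      (deriv (fun z : ℂ => ∑ k ∈ Finset.range d, z ^ k • a k) z *
        Ring.inverse (∑ k ∈ Finset.range d, z ^ k • a k))) ∈ T.onKZero.range := by
  -- Two zero coefficients are appended, since the induction needs at least two terms.
  have e : ∀ z : ℂ, ∑ k ∈ Finset.range (d + 2), z ^ k • (if k < d then a k else 0) =
      ∑ k ∈ Finset.range d, z ^ k • a k := by
    intro z
    rw [Finset.sum_range_succ, Finset.sum_range_succ]
    simp only [lt_irrefl, if_false, smul_zero, add_zero, show ¬ d + 1 < d by omega]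
    exact Finset.sum_congr rfl fun k hk => by rw [if_pos (Finset.mem_range.1 hk)]
  have := circleIntegral_polynomial_mem_range_aux d T (fun k => if k < d then a k else 0)
  simp only [e] at this
  exact this h

end Polynomial

/-! ### Approximation of loops by Laurent polynomials -/

section Approximation

open Filter Topology unitInterval

variable {E : Type*} [NormedAddCommGroup E] [NormedSpace ℂ E]

/-- The projection from the unit interval to the circle `ℝ/ℤ`. -/
def circleProj : C(I, AddCircle (1 : ℝ)) where
  toFun s := ((s : ℝ) : AddCircle (1 : ℝ))
  continuous_toFun := (AddCircle.continuous_mk' 1).comp continuous_subtype_val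

/-- The map `f ↦ f a` from scalar functions on the circle to vector-valued loops. -/
def smulLoop (a : E) : C(AddCircle (1 : ℝ), ℂ) →L[ℂ] C(I, E) where
  toFun f := ⟨fun s => f (circleProj s) • a, by fun_prop⟩
  map_add' f g := by ext s; simp [add_smul]
  map_smul' c f := by ext s; simp [mul_smul]
  cont := ContinuousMap.continuous_of_continuous_uncurry _ (by
    change Continuous fun p : C(AddCircle (1 : ℝ), ℂ) × I => p.1 (circleProj p.2) • a
    fun_prop)

variable (E) in
/-- The space of vector-valued trigonometric polynomials. -/
def trigPolynomials : Submodule ℂ C(I, E) :=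
  Submodule.span ℂ (Set.range fun p : ℤ × E => smulLoop p.2 (fourier p.1))

/-- The density of scalar trigonometric polynomials is carried over by the continuous linear map `f
↦ f a`. -/
theorem smulLoop_mem_closure (a : E) (f : C(AddCircle (1 : ℝ), ℂ)) :
    smulLoop a f ∈ (trigPolynomials E).topologicalClosure := by
  have hf : f ∈ (Submodule.span ℂ (Set.range (fourier (T := 1)))).topologicalClosure := by
    rw [span_fourier_closure_eq_top]
    trivial
  refine map_mem_closure (smulLoop a).continuous hf fun g hg => ?_
  have h1 : (Submodule.span ℂ (Set.range (fourier (T := 1)))).map (smulLoop a).toLinearMap ≤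
      trigPolynomials E := by
    rw [Submodule.map_span_le]
    rintro _ ⟨n, rfl⟩
    exact Submodule.subset_span ⟨(n, a), rfl⟩
  exact h1 (Submodule.mem_map_of_mem hg)

/-- For `0 < k < n` the Bernstein polynomial vanishes at both ends, hence descends to a continuous
function on the circle. -/
theorem bernstein_smul_mem_closure (a : E) {n k : ℕ} (hk : k ≠ 0) (hkn : k < n) :
    bernstein n k • ContinuousMap.const I a ∈ (trigPolynomials E).topologicalClosure := by
  set b : ℝ → ℂ := fun x => ((n.choose k * x ^ k * (1 - x) ^ (n - k) : ℝ) : ℂ) with hb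
  have hn : n - k ≠ 0 := by omega
  have h0 : b 0 = 0 := by simp [hb, hk]
  have h1 : b 1 = 0 := by simp [hb, hn]
  let f : C(AddCircle (1 : ℝ), ℂ) := ⟨AddCircle.liftIco 1 0 b,
    AddCircle.liftIco_continuous (by rw [zero_add, h0, h1]) (by fun_prop)⟩
  have hfb : ∀ x ∈ Set.Ico (0 : ℝ) 1, f (x : AddCircle (1 : ℝ)) = b x := fun x hx => by
    change AddCircle.liftIco 1 0 b (x : AddCircle (1 : ℝ)) = b x
    exact AddCircle.liftIco_zero_coe_apply hx
  have hf : ∀ s : I, f (circleProj s) = b s := by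
    intro s
    rcases s.2.2.lt_or_eq with hs | hs
    · exact hfb s ⟨s.2.1, hs⟩
    · have : circleProj s = ((0 : ℝ) : AddCircle (1 : ℝ)) := by
        change ((s : ℝ) : AddCircle (1 : ℝ)) = _
        rw [hs, AddCircle.coe_period]
        rfl
      rw [this, hs, h1, ← h0]
      exact hfb 0 ⟨le_rfl, one_pos⟩
  convert! smulLoop_mem_closure a f using 1
  ext s
  change bernstein n k s • a = f (circleProj s) • a
  rw [hf, hb, bernstein_apply]
  exact (Complex.coe_smul _ _).symm

/-- Bernstein approximation reduces the vector-valued statement to the scalar one, its terms being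
scalar functions times fixed vectors. Subtracting the constant `f 0` kills the terms `k = 0` and `k
= n`, the only ones which do not vanish at both ends. -/
theorem mem_closure_trigPolynomials (f : C(I, E)) (hf : f 0 = f 1) :
    f ∈ (trigPolynomials E).topologicalClosure := by
  set g : C(I, E) := f - ContinuousMap.const I (f 0) with hg
  have hc : ContinuousMap.const I (f 0) ∈ (trigPolynomials E).topologicalClosure := by
    convert! smulLoop_mem_closure (f 0) (fourier 0) using 1
    ext s
    change f 0 = fourier 0 (circleProj s) • f 0
    rw [fourier_zero, one_smul]
  have hg' : g ∈ (trigPolynomials E).topologicalClosure := by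
    refine (trigPolynomials E).isClosed_topologicalClosure.mem_of_tendsto
      (bernsteinApproximation_uniform g) ((eventually_gt_atTop 0).mono fun n hn => ?_)
    refine Submodule.sum_mem _ fun k _ => ?_
    by_cases hk0 : (k : ℕ) = 0
    · have : k = 0 := Fin.ext hk0
      subst this
      have : g (bernstein.z (n := n) 0) = 0 := by simp [hg]
      rw [this]
      simp
    by_cases hkn : (k : ℕ) = n
    · have : k = Fin.last n := Fin.ext hkn
      subst this
      have : g (bernstein.z (Fin.last n)) = 0 := by rw [bernstein.z_last hn.ne']; simp [hg, hf]
      rw [this]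
      simp
    exact bernstein_smul_mem_closure _ hk0 (by omega)
  have := Submodule.add_mem _ hg' hc
  rwa [hg, sub_add_cancel] at this

theorem exists_finsupp_of_mem_trigPolynomials {f : C(I, E)} (hf : f ∈ trigPolynomials E) :
    ∃ c : ℤ →₀ E, ∀ s : I, f s = c.sum fun n a => (circleMap 0 1 (2 * Real.pi * s)) ^ n • a := by
  induction hf using Submodule.span_induction with
  | mem f hf =>
    obtain ⟨⟨n, a⟩, rfl⟩ := hf
    refine ⟨Finsupp.single n a, fun s => ?_⟩
    refine Eq.trans ?_ (Finsupp.sum_single_index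
      (h := fun n a => (circleMap 0 1 (2 * Real.pi * s) : ℂ) ^ n • a) (smul_zero _)).symm
    change fourier n ((s : ℝ) : AddCircle (1 : ℝ)) • a = _
    rw [fourier_coe_apply]
    congr 1
    simp only [circleMap]
    push_cast
    rw [zero_add, one_mul, ← Complex.exp_int_mul]
    congr 1
    ring
  | zero => exact ⟨0, fun s => by simp⟩
  | add f g _ _ hf hg =>
    obtain ⟨c, hc⟩ := hf
    obtain ⟨d, hd⟩ := hg
    refine ⟨c + d, fun s => ?_⟩
    rw [Finsupp.sum_add_index' (fun _ => smul_zero _) (fun _ _ _ => smul_add _ _ _), ← hc, ← hd]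
    rfl
  | smul x f _ hf =>
    obtain ⟨c, hc⟩ := hf
    refine ⟨x • c, fun s => ?_⟩
    rw [Finsupp.sum_smul_index' (fun _ => smul_zero _)]
    simp only [smul_comm _ x]
    rw [← Finsupp.smul_sum, ← hc]
    rfl

theorem finsupp_sum_zpow_smul (c : ℤ →₀ E) : ∃ (N d : ℕ) (a : ℕ → E), ∀ z : ℂ, z ≠ 0 →
    (c.sum fun n x => z ^ n • x) = z ^ (-(N : ℤ)) • ∑ k ∈ Finset.range d, z ^ k • a k := by
  set N := c.support.sup Int.natAbs
  -- The exponents lie in `[-N, N]`; shifting by `N` leaves the powers `0, …, 2N`. The subtraction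
  -- `k - N` is in `ℤ`.
  refine ⟨N, 2 * N + 1, fun k => c (k - N), fun z hz => ?_⟩
  have hinj : Function.Injective fun k : ℕ => (k : ℤ) - N := fun a b h => by simpa using h
  rw [Finsupp.sum_of_support_subset (s := (Finset.range (2 * N + 1)).image fun k : ℕ => (k : ℤ) - N),
    Finset.sum_image hinj.injOn, Finset.smul_sum]
  · refine Finset.sum_congr rfl fun k _ => ?_
    rw [smul_smul, ← zpow_natCast, ← zpow_add₀ hz, neg_add_eq_sub]
  · intro n hn
    have : n.natAbs ≤ N := Finset.le_sup hn
    exact Finset.mem_image.2 ⟨(n + N).toNat, by simp; omega, by simp; omega⟩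
  · exact fun _ _ => smul_zero _

/-- A continuous loop in a normed space is a uniform limit of Laurent polynomials. -/
theorem exists_laurent_approx {f : ℝ → E} (hf : ContinuousOn f (Set.Icc 0 1)) (h01 : f 0 = f 1)
    {ε : ℝ} (hε : 0 < ε) : ∃ (N d : ℕ) (a : ℕ → E), ∀ s ∈ Set.Icc (0 : ℝ) 1,
      ‖f s - circleMap 0 1 (2 * Real.pi * s) ^ (-(N : ℤ)) •
        ∑ k ∈ Finset.range d, circleMap 0 1 (2 * Real.pi * s) ^ k • a k‖ < ε := by
  let F : C(I, E) := ⟨fun s => f s, continuousOn_iff_continuous_domRestrict.1 hf⟩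
  have hF := mem_closure_trigPolynomials F h01
  obtain ⟨g, hg, hgF⟩ := Metric.mem_closure_iff.1 hF ε hε
  obtain ⟨c, hc⟩ := exists_finsupp_of_mem_trigPolynomials hg
  obtain ⟨N, d, a, ha⟩ := finsupp_sum_zpow_smul c
  refine ⟨N, d, a, fun s hs => ?_⟩
  rw [← ha _ (by simp [circleMap]), ← hc ⟨s, hs⟩, ← dist_eq_norm]
  exact (ContinuousMap.dist_apply_le_dist (f := F) (g := g) ⟨s, hs⟩).trans_lt hgF

end Approximation

/-! ### Logarithmic derivatives of paths -/

section LogDeriv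

open MeasureTheory Set

variable {M : Type*} [NormedRing M] [NormedAlgebra ℂ M]

/-- A path `f : [0,1] → GL_1(M)` which is the primitive of an integrable function `f'`, with
derivative `f'` outside a countable set. -/
structure IsAdmissiblePath (f f' : ℝ → M) : Prop where
  continuousOn : ContinuousOn f (Icc 0 1)
  hasDerivAt : ∃ s : Set ℝ, s.Countable ∧ ∀ x ∈ Ioo (0 : ℝ) 1 \ s, HasDerivAt f (f' x) x
  intervalIntegrable : IntervalIntegrable f' volume 0 1
  isUnit : ∀ x ∈ Icc (0 : ℝ) 1, IsUnit (f x)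

/-- The integral `∫_0^1 T(f' f⁻¹)`. -/
def logIntegral (T : BTrace M) (f f' : ℝ → M) : ℂ :=
  ∫ x in (0 : ℝ)..1, T.toCLM (f' x * Ring.inverse (f x))

variable {f f' g g' : ℝ → M}

theorem IsAdmissiblePath.inverse_continuousOn [CompleteSpace M] (hf : IsAdmissiblePath f f') :
    ContinuousOn (fun x => Ring.inverse (f x)) (Icc 0 1) := fun x hx => by
  obtain ⟨u, hu⟩ := hf.isUnit x hx
  have h1 : ContinuousAt Ring.inverse (f x) := hu ▸ NormedRing.inverse_continuousAt u
  exact h1.comp_continuousWithinAt (hf.continuousOn x hx)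

theorem IsAdmissiblePath.logDeriv_intervalIntegrable [CompleteSpace M] (hf : IsAdmissiblePath f f') :
    IntervalIntegrable (fun x => f' x * Ring.inverse (f x)) volume 0 1 :=
  hf.intervalIntegrable.mul_continuousOn
    (by rw [uIcc_of_le zero_le_one]; exact hf.inverse_continuousOn)

theorem clm_intervalIntegrable (T : BTrace M) {h : ℝ → M} {a b : ℝ}
    (hh : IntervalIntegrable h volume a b) :
    IntervalIntegrable (fun x => T.toCLM (h x)) volume a b :=
  ⟨T.toCLM.integrable_comp hh.1, T.toCLM.integrable_comp hh.2⟩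

theorem IsAdmissiblePath.mul (hf : IsAdmissiblePath f f') (hg : IsAdmissiblePath g g') :
    IsAdmissiblePath (fun x => f x * g x) (fun x => f' x * g x + f x * g' x) where
  continuousOn := hf.continuousOn.mul hg.continuousOn
  hasDerivAt := by
    obtain ⟨s, hs, hsd⟩ := hf.hasDerivAt
    obtain ⟨t, ht, htd⟩ := hg.hasDerivAt
    exact ⟨s ∪ t, hs.union ht, fun x hx => (hsd x ⟨hx.1, fun h => hx.2 (.inl h)⟩).mul
      (htd x ⟨hx.1, fun h => hx.2 (.inr h)⟩)⟩
  intervalIntegrable := by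
    refine IntervalIntegrable.add ?_ ?_
    · exact hf.intervalIntegrable.mul_continuousOn
        (by rw [uIcc_of_le zero_le_one]; exact hg.continuousOn)
    · exact hg.intervalIntegrable.continuousOn_mul
        (by rw [uIcc_of_le zero_le_one]; exact hf.continuousOn)
  isUnit x hx := (hf.isUnit x hx).mul (hg.isUnit x hx)

theorem IsAdmissiblePath.inverse [CompleteSpace M] (hf : IsAdmissiblePath f f') :
    IsAdmissiblePath (fun x => Ring.inverse (f x))
      (fun x => -(Ring.inverse (f x) * f' x * Ring.inverse (f x))) where
  continuousOn := hf.inverse_continuousOn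
  hasDerivAt := by
    obtain ⟨s, hs, hsd⟩ := hf.hasDerivAt
    refine ⟨s, hs, fun x hx => ?_⟩
    obtain ⟨u, hu⟩ := hf.isUnit x (Ioo_subset_Icc_self hx.1)
    have h1 : HasFDerivAt Ring.inverse _ (f x) := hu ▸ hasFDerivAt_ringInverse (𝕜 := ℝ) u
    have h2 : HasDerivAt (fun x => Ring.inverse (f x)) _ x := h1.comp_hasDerivAt x (hsd x hx)
    refine h2.congr_deriv ?_
    rw [← hu, Ring.inverse_unit]
    simp
  intervalIntegrable := by
    refine IntervalIntegrable.neg ?_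
    have h := hf.inverse_continuousOn
    rw [← uIcc_of_le zero_le_one] at h
    exact (hf.intervalIntegrable.continuousOn_mul h).mul_continuousOn h
  isUnit x hx := by
    obtain ⟨u, hu⟩ := hf.isUnit x hx
    rw [← hu, Ring.inverse_unit]
    exact Units.isUnit _

/-- The second term of the logarithmic derivative of `f g` is `f (g' g⁻¹) f⁻¹`, and a trace is
invariant under conjugation. -/
theorem logIntegral_mul [CompleteSpace M] (T : BTrace M) (hf : IsAdmissiblePath f f')
    (hg : IsAdmissiblePath g g') :
    logIntegral T (fun x => f x * g x) (fun x => f' x * g x + f x * g' x) =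
      logIntegral T f f' + logIntegral T g g' := by
  rw [logIntegral, logIntegral, logIntegral, ← intervalIntegral.integral_add
    (clm_intervalIntegrable T hf.logDeriv_intervalIntegrable)
    (clm_intervalIntegrable T hg.logDeriv_intervalIntegrable)]
  refine intervalIntegral.integral_congr fun x hx => ?_
  rw [uIcc_of_le zero_le_one] at hx
  obtain ⟨u, hu⟩ := hf.isUnit x hx
  obtain ⟨v, hv⟩ := hg.isUnit x hx
  simp only [← hu, ← hv, ← Units.val_mul, Ring.inverse_unit, mul_inv_rev]
  rw [add_mul, map_add]
  congr 1
  · simp [mul_assoc]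
  · rw [mul_assoc, T.tracial]
    simp [mul_assoc]

theorem logIntegral_inverse (T : BTrace M) (hf : IsAdmissiblePath f f') :
    logIntegral T (fun x => Ring.inverse (f x))
      (fun x => -(Ring.inverse (f x) * f' x * Ring.inverse (f x))) = -logIntegral T f f' := by
  rw [logIntegral, logIntegral, ← intervalIntegral.integral_neg]
  refine intervalIntegral.integral_congr fun x hx => ?_
  rw [uIcc_of_le zero_le_one] at hx
  obtain ⟨u, hu⟩ := hf.isUnit x hx
  simp only [← hu, Ring.inverse_unit, inv_inv]
  rw [neg_mul, map_neg, mul_assoc, Units.inv_mul, mul_one, T.tracial]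

/-- Under a trace all the terms of the noncommutative derivative of `f ^ (k + 1)` agree, so `(k + 1)
T(f' f^k)` is the derivative of `T(f ^ (k + 1))`, and the loop closes up. -/
theorem integral_mul_pow_eq_zero (T : BTrace M) (hf : ContinuousOn f (Icc 0 1))
    (hd : ∃ s : Set ℝ, s.Countable ∧ ∀ x ∈ Ioo (0 : ℝ) 1 \ s, HasDerivAt f (f' x) x)
    (hi : IntervalIntegrable f' volume 0 1) (h01 : f 0 = f 1) (k : ℕ) :
    ∫ x in (0 : ℝ)..1, T.toCLM (f' x * f x ^ k) = 0 := by
  obtain ⟨s, hs, hsd⟩ := hd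
  have h1 : ∫ x in (0 : ℝ)..1, ((k + 1 : ℕ) : ℂ) * T.toCLM (f' x * f x ^ k) =
      T.toCLM (f 1 ^ (k + 1)) - T.toCLM (f 0 ^ (k + 1)) := by
    refine integral_eq_of_hasDerivAt_off_countable_of_le (fun x => T.toCLM (f x ^ (k + 1))) _
      zero_le_one hs (T.toCLM.continuous.comp_continuousOn (hf.pow _)) (fun x hx => ?_) ?_
    · have h2 := (T.toCLM.restrictScalars ℝ).hasFDerivAt.comp_hasDerivAt x
        ((hsd x hx).fun_pow' (k + 1))
      convert! h2 using 1
      rw [map_sum]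
      have : ∀ i ∈ Finset.range (k + 1), (T.toCLM.restrictScalars ℝ)
          (f x ^ ((k + 1).pred - i) * f' x * f x ^ i) = T.toCLM (f' x * f x ^ k) := by
        intro i hi
        rw [ContinuousLinearMap.coe_restrictScalars', mul_assoc, T.tracial, mul_assoc, ← pow_add]
        congr 3
        have := Finset.mem_range.1 hi
        simp only [Nat.pred_eq_sub_one]
        omega
      rw [Finset.sum_congr rfl this]
      simp
    · refine (clm_intervalIntegrable T (hi.mul_continuousOn ?_)).const_mul _
      rw [uIcc_of_le zero_le_one]
      exact hf.pow k
  rw [intervalIntegral.integral_const_mul, h01, sub_self] at h1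
  exact (mul_eq_zero.1 h1).resolve_left (by exact_mod_cast Nat.succ_ne_zero k)

/-- With `v = 1 - f`, the expansion `f⁻¹ = ∑ v^k` is dominated by a geometric series, and each `T(f'
v^k)` integrates to zero over the loop. It replaces the argument that `T(log f)` is a primitive. -/
theorem logIntegral_eq_zero [CompleteSpace M] (T : BTrace M) (hf : IsAdmissiblePath f f') (h01 : f 0 = f 1)
    {r : ℝ} (hr : r < 1) (hfr : ∀ x ∈ Icc (0 : ℝ) 1, ‖f x - 1‖ ≤ r) : logIntegral T f f' = 0 := by
  have hr0 : 0 ≤ r := (norm_nonneg _).trans (hfr 0 ⟨le_rfl, zero_le_one⟩)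
  set v : ℝ → M := fun x => 1 - f x with hv
  have hvr : ∀ x ∈ Icc (0 : ℝ) 1, ‖v x‖ ≤ r := fun x hx => by
    rw [hv, norm_sub_rev]; exact hfr x hx
  have hvc : ContinuousOn v (Icc 0 1) := continuousOn_const.sub hf.continuousOn
  have hzero : ∀ k : ℕ, ∫ x in (0 : ℝ)..1, T.toCLM (f' x * v x ^ k) = 0 := by
    intro k
    have := integral_mul_pow_eq_zero T (f := v) (f' := fun x => -f' x) hvc
      (by
        obtain ⟨s, hs, hsd⟩ := hf.hasDerivAt
        exact ⟨s, hs, fun x hx => (hsd x hx).const_sub 1⟩)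
      hf.intervalIntegrable.neg (by simp [hv, h01]) k
    simpa using this
  -- The product with `f'` is bounded, and not `v^k` alone, because `‖1‖ ≤ 1` is not assumed.
  have hbound : ∀ x ∈ Icc (0 : ℝ) 1, ∀ k : ℕ, ‖f' x * v x ^ k‖ ≤ ‖f' x‖ * r ^ k := by
    intro x hx k
    induction k with
    | zero => simp
    | succ k ih =>
      calc ‖f' x * v x ^ (k + 1)‖ = ‖f' x * v x ^ k * v x‖ := by rw [pow_succ, mul_assoc]
        _ ≤ ‖f' x * v x ^ k‖ * ‖v x‖ := norm_mul_le _ _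
        _ ≤ ‖f' x‖ * r ^ k * r := mul_le_mul ih (hvr x hx) (norm_nonneg _) (by positivity)
        _ = ‖f' x‖ * r ^ (k + 1) := by ring
  have hsum : HasSum (fun k : ℕ => ∫ x in (0 : ℝ)..1, T.toCLM (f' x * v x ^ k))
      (logIntegral T f f') := by
    have hmem : ∀ {x : ℝ}, x ∈ uIoc (0 : ℝ) 1 → x ∈ Icc (0 : ℝ) 1 := fun {x} hx => by
      rw [uIoc_of_le zero_le_one] at hx
      exact Ioc_subset_Icc_self hx
    refine intervalIntegral.hasSum_integral_of_dominated_convergence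
      (fun k x => ‖T.toCLM‖ * ‖f' x‖ * r ^ k) (fun k => ?_) (fun k => ?_) ?_ ?_ ?_
    · refine (intervalIntegrable_iff.1 (clm_intervalIntegrable T
        (hf.intervalIntegrable.mul_continuousOn (g := fun x => v x ^ k) ?_))).aestronglyMeasurable
      rw [uIcc_of_le zero_le_one]
      exact hvc.pow k
    · refine Filter.Eventually.of_forall fun x hx => ?_
      rw [mul_assoc]
      exact (T.toCLM.le_opNorm _).trans
        (mul_le_mul_of_nonneg_left (hbound x (hmem hx) k) (norm_nonneg _))
    · exact Filter.Eventually.of_forall fun x _ => (summable_geometric_of_lt_one hr0 hr).mul_left _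
    · simp only [tsum_mul_left]
      exact (hf.intervalIntegrable.norm.const_mul _).mul_const _
    · refine Filter.Eventually.of_forall fun x hx => ?_
      have h1 : HasSum (fun k => v x ^ k) (Ring.inverse (1 - v x)) :=
        hasSum_geom_series_inverse (v x) ((hvr x (hmem hx)).trans_lt hr)
      have h2 := (T.toCLM.hasSum (h1.mul_left (f' x)))
      simpa [hv] using h2
  simp only [hzero] at hsum
  exact hsum.unique hasSum_zero

/-- Two loops which are close to each other have the same logarithmic integral. -/
theorem logIntegral_eq_of_close [CompleteSpace M] (T : BTrace M) (hf : IsAdmissiblePath f f')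
    (hg : IsAdmissiblePath g g') (hf01 : f 0 = f 1) (hg01 : g 0 = g 1) {r : ℝ} (hr : r < 1)
    (h : ∀ x ∈ Icc (0 : ℝ) 1, ‖g x * Ring.inverse (f x) - 1‖ ≤ r) :
    logIntegral T f f' = logIntegral T g g' := by
  -- The previous lemma is applied to the loop `g f⁻¹`, which stays near `1`.
  have := logIntegral_eq_zero T (hg.mul hf.inverse) (by simp only [hf01, hg01]) hr h
  rw [logIntegral_mul T hg hf.inverse, logIntegral_inverse T hf] at this
  linear_combination -this

end LogDeriv

/-! ### Logarithmic integrals of loops -/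

section Loop

open MeasureTheory Set

variable {M : Type*} [NormedRing M] [NormedAlgebra ℂ M]

theorem hasDerivAt_circleMap_two_pi_mul (s : ℝ) :
    HasDerivAt (fun s : ℝ => circleMap 0 1 (2 * Real.pi * s))
      ((2 * Real.pi * Complex.I) * circleMap 0 1 (2 * Real.pi * s)) s := by
  have h := (hasDerivAt_circleMap 0 1 (2 * Real.pi * s)).scomp s
    ((hasDerivAt_id s).const_mul (2 * Real.pi))
  refine h.congr_deriv ?_
  simp only [mul_one, Complex.real_smul]
  push_cast
  ring

theorem circleMap_two_pi_mul_one :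
    circleMap 0 1 (2 * Real.pi * 1) = circleMap 0 1 (2 * Real.pi * 0) := by
  simp [circleMap]

theorem isAdmissiblePath_of_hasDerivAt {f f' : ℝ → M} (hd : ∀ x, HasDerivAt f (f' x) x)
    (hc : Continuous f') (hu : ∀ x ∈ Icc (0 : ℝ) 1, IsUnit (f x)) : IsAdmissiblePath f f' where
  continuousOn := fun x _ => (hd x).continuousAt.continuousWithinAt
  hasDerivAt := ⟨∅, countable_empty, fun x _ => hd x⟩
  intervalIntegrable := hc.intervalIntegrable _ _
  isUnit := hu

theorem isUnit_smul_one {c : ℂ} (hc : c ≠ 0) : IsUnit (c • (1 : M)) := by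
  rw [← Algebra.algebraMap_eq_smul_one]
  exact (IsUnit.mk0 c hc).map (algebraMap ℂ M)

/-- The loop `s ↦ z(s)^{-N}`, with `z(s) = e^{2πis}`. -/
theorem isAdmissiblePath_zpow (N : ℕ) : IsAdmissiblePath
    (fun s : ℝ => circleMap 0 1 (2 * Real.pi * s) ^ (-(N : ℤ)) • (1 : M))
    (fun s : ℝ => ((-N : ℂ) * (2 * Real.pi * Complex.I) *
      circleMap 0 1 (2 * Real.pi * s) ^ (-(N : ℤ))) • (1 : M)) := by
  have hz : ∀ s : ℝ, circleMap 0 1 (2 * Real.pi * s) ≠ 0 := fun s => by simp [circleMap]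
  have hc : Continuous fun s : ℝ => circleMap 0 1 (2 * Real.pi * s) ^ (-(N : ℤ)) :=
    ((continuous_circleMap 0 1).comp (by fun_prop)).zpow₀ _ fun s => .inl (hz s)
  refine isAdmissiblePath_of_hasDerivAt (fun s => ?_) ?_ fun s _ => ?_
  · have h := (hasDerivAt_zpow (-(N : ℤ)) _ (.inl (hz s))).comp s (hasDerivAt_circleMap_two_pi_mul s)
    refine HasDerivAt.smul_const (h.congr_deriv ?_) (1 : M)
    rw [zpow_sub_one₀ (hz s)]
    have := hz s
    field_simp
    push_cast
    ring
  · exact (continuous_const.mul hc).smul continuous_const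
  · exact isUnit_smul_one (zpow_ne_zero _ (hz s))

theorem logIntegral_zpow (T : BTrace M) (N : ℕ) : logIntegral T
    (fun s : ℝ => circleMap 0 1 (2 * Real.pi * s) ^ (-(N : ℤ)) • (1 : M))
    (fun s : ℝ => ((-N : ℂ) * (2 * Real.pi * Complex.I) *
      circleMap 0 1 (2 * Real.pi * s) ^ (-(N : ℤ))) • (1 : M)) =
    (2 * Real.pi * Complex.I) * ((-N : ℤ) • T.toCLM 1) := by
  have h : ∀ s : ℝ, T.toCLM ((((-N : ℂ) * (2 * Real.pi * Complex.I) *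
      circleMap 0 1 (2 * Real.pi * s) ^ (-(N : ℤ))) • (1 : M)) *
      Ring.inverse (circleMap 0 1 (2 * Real.pi * s) ^ (-(N : ℤ)) • (1 : M))) =
      (2 * Real.pi * Complex.I) * ((-N : ℤ) • T.toCLM 1) := by
    intro s
    have hz : circleMap 0 1 (2 * Real.pi * s) ^ (-(N : ℤ)) ≠ 0 :=
      zpow_ne_zero _ (by simp [circleMap])
    have hu : IsUnit (circleMap 0 1 (2 * Real.pi * s) ^ (-(N : ℤ)) • (1 : M)) :=
      isUnit_smul_one hz
    rw [mul_smul, smul_mul_assoc, Ring.mul_inverse_cancel _ hu, map_smul]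
    simp only [smul_eq_mul, zsmul_eq_mul]
    push_cast
    ring
  simp only [logIntegral, h]
  simp

variable [CompleteSpace M]

/-- The loop `s ↦ p(e^{2πis})`, for a polynomial `p`. -/
theorem logIntegral_polynomial_mem_range (T : BTrace M) (a : ℕ → M) (d : ℕ)
    (h : ∀ s ∈ Icc (0 : ℝ) 1,
      IsUnit (∑ k ∈ Finset.range d, circleMap 0 1 (2 * Real.pi * s) ^ k • a k)) :
    ∃ p' : ℝ → M,
      IsAdmissiblePath (fun s => ∑ k ∈ Finset.range d, circleMap 0 1 (2 * Real.pi * s) ^ k • a k) p' ∧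
      (2 * Real.pi * Complex.I)⁻¹ * logIntegral T
        (fun s => ∑ k ∈ Finset.range d, circleMap 0 1 (2 * Real.pi * s) ^ k • a k) p' ∈
        T.onKZero.range := by
  set p : ℂ → M := fun z => ∑ k ∈ Finset.range d, z ^ k • a k with hp
  have hpd : ContDiff ℂ 1 p := by rw [hp]; fun_prop
  refine ⟨fun s => ((2 * Real.pi * Complex.I) * circleMap 0 1 (2 * Real.pi * s)) •
    deriv p (circleMap 0 1 (2 * Real.pi * s)), ?_, ?_⟩
  · refine isAdmissiblePath_of_hasDerivAt (fun s => ?_) ?_ h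
    · exact ((hpd.differentiable one_ne_zero _).hasDerivAt).scomp s
        (hasDerivAt_circleMap_two_pi_mul s)
    · have h1 : Continuous fun s : ℝ => circleMap 0 1 (2 * Real.pi * s) :=
        (continuous_circleMap 0 1).comp (by fun_prop)
      exact (continuous_const.mul h1).smul ((hpd.continuous_deriv le_rfl).comp h1)
  · have hu : ∀ z : ℂ, ‖z‖ = 1 → IsUnit (p z) := by
      intro z hz
      -- Invertibility is given along the parametrization; every point of the circle is reached at a
      -- time `t / 2π` in `[0, 1]`.
      have hz' : z ∈ circleMap 0 1 '' Ioc 0 (2 * Real.pi) := by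
        rw [image_circleMap_Ioc]; simpa using hz
      obtain ⟨t, ht, rfl⟩ := hz'
      have hpi : 0 < 2 * Real.pi := by positivity
      have := h (t / (2 * Real.pi)) ⟨div_nonneg ht.1.le hpi.le, (div_le_one hpi).2 ht.2⟩
      rwa [mul_div_cancel₀ _ hpi.ne'] at this
    have := circleIntegral_polynomial_mem_range T a d hu
    convert! this using 2
    set F : ℂ → ℂ := fun z => T.toCLM (deriv p z * Ring.inverse (p z)) with hF
    change logIntegral T (fun s => p (circleMap 0 1 (2 * Real.pi * s))) _ = ∮ z in C(0, 1), F z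
    -- The substitution `t = 2πs` identifies the logarithmic integral with the contour integral.
    have h2 := intervalIntegral.smul_integral_comp_mul_left
      (f := fun t => deriv (circleMap 0 1) t • F (circleMap 0 1 t)) (a := 0) (b := 1) (2 * Real.pi)
    rw [mul_zero, mul_one] at h2
    rw [circleIntegral, ← h2, logIntegral, ← intervalIntegral.integral_smul]
    refine intervalIntegral.integral_congr fun s _ => ?_
    simp only [hF, deriv_circleMap, smul_mul_assoc, map_smul, smul_eq_mul, Complex.real_smul]
    push_cast
    ring

/-- The logarithmic integral of a loop is `2πi` times an element of the range of the trace
on `K_0`. -/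
theorem logIntegral_loop_mem_range (T : BTrace M) {f f' : ℝ → M} (hf : IsAdmissiblePath f f')
    (h01 : f 0 = f 1) : (2 * Real.pi * Complex.I)⁻¹ * logIntegral T f f' ∈ T.onKZero.range := by
  obtain ⟨K, hK⟩ := isCompact_Icc.exists_bound_of_continuousOn hf.inverse_continuousOn
  have hK0 : 0 ≤ K := (norm_nonneg _).trans (hK 0 ⟨le_rfl, zero_le_one⟩)
  -- Since `K` bounds `‖f⁻¹‖`, this precision puts the Laurent loop times `f⁻¹` within `1/2` of `1`;
  -- `K + 1` keeps the denominator positive.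
  obtain ⟨N, d, a, ha⟩ := exists_laurent_approx hf.continuousOn h01
    (ε := 1 / (2 * (K + 1))) (by positivity)
  set z : ℝ → ℂ := fun s => circleMap 0 1 (2 * Real.pi * s) with hz
  set p : ℝ → M := fun s => ∑ k ∈ Finset.range d, z s ^ k • a k with hp
  have hzu : ∀ s, IsUnit (z s ^ (-(N : ℤ)) • (1 : M)) := fun s =>
    isUnit_smul_one (zpow_ne_zero _ (by simp [hz, circleMap]))
  have hclose : ∀ s ∈ Icc (0 : ℝ) 1,
      ‖z s ^ (-(N : ℤ)) • (1 : M) * p s * Ring.inverse (f s) - 1‖ ≤ 1 / 2 := by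
    intro s hs
    have h1 : z s ^ (-(N : ℤ)) • (1 : M) * p s * Ring.inverse (f s) - 1 =
        (z s ^ (-(N : ℤ)) • p s - f s) * Ring.inverse (f s) := by
      rw [sub_mul, Ring.mul_inverse_cancel _ (hf.isUnit s hs), smul_one_mul]
    rw [h1]
    calc _ ≤ ‖z s ^ (-(N : ℤ)) • p s - f s‖ * ‖Ring.inverse (f s)‖ := norm_mul_le _ _
      _ ≤ (1 / (2 * (K + 1))) * (K + 1) := by
          rw [norm_sub_rev]
          exact mul_le_mul (ha s hs).le ((hK s hs).trans (by linarith)) (norm_nonneg _)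
            (by positivity)
      _ = 1 / 2 := by field_simp
  -- By the Neumann series `z^{-N} p f⁻¹` is invertible; the other two factors are units, hence so
  -- is `p`.
  have hpu : ∀ s ∈ Icc (0 : ℝ) 1, IsUnit (p s) := by
    intro s hs
    have h1 : IsUnit (z s ^ (-(N : ℤ)) • (1 : M) * p s * Ring.inverse (f s)) := by
      have := isUnit_one_sub_of_norm_lt_one (x := 1 - z s ^ (-(N : ℤ)) • (1 : M) * p s * Ring.inverse (f s))
        (by rw [norm_sub_rev]; exact (hclose s hs).trans_lt (by norm_num))
      rwa [sub_sub_cancel] at this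
    have h2 : IsUnit (z s ^ (-(N : ℤ)) • (1 : M) * p s) := by
      have := h1.mul (hf.isUnit s hs)
      rwa [mul_assoc, Ring.inverse_mul_cancel _ (hf.isUnit s hs), mul_one] at this
    exact ((hzu s).mul_left_iff).1 h2
  obtain ⟨p', hp', hmem⟩ := logIntegral_polynomial_mem_range T a d hpu
  have hzN := isAdmissiblePath_zpow (M := M) N
  rw [logIntegral_eq_of_close T hf (hzN.mul hp') h01 ?_ (r := 1 / 2) (by norm_num) hclose,
    logIntegral_mul T hzN hp', logIntegral_zpow, mul_add, inv_mul_cancel_left₀ Complex.two_pi_I_ne_zero]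
  -- The contribution `-N T(1)` of the pole is in the range because `1` is an idempotent.
  · exact add_mem (zsmul_mem (T.apply_mem_range (one_mul 1)) _) hmem
  · simp only [circleMap_two_pi_mul_one]

end Loop

/-! ### Piecewise differentiable paths as admissible paths -/

section Piecewise

open MeasureTheory Set

theorem continuousOn_of_piecewise {M : Type*} [TopologicalSpace M] {F : ℝ → M} {N : ℕ}
    {t : ℕ → ℝ} (ht : Monotone t)
    (hF : ∀ m < N, ContinuousOn F (Icc (t m) (t (m + 1)))) : ContinuousOn F (Icc (t 0) (t N)) := by
  induction N with
  | zero => simp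
  | succ N ih =>
    rw [← Icc_union_Icc_eq_Icc (ht (Nat.zero_le N)) (ht (Nat.le_succ N))]
    exact (ih fun m hm => hF m (hm.trans N.lt_succ_self)).union_of_isClosed
      (hF N N.lt_succ_self) isClosed_Icc isClosed_Icc

variable {M : Type*} [NormedRing M] [NormedAlgebra ℂ M] {F G : ℝ → M} {N : ℕ} {t : ℕ → ℝ}

theorem exists_mem_Ioo_of_piecewise {x : ℝ} (hx : x ∈ Ioo (t 0) (t N)) (hxt : x ∉ range t) :
    ∃ m < N, x ∈ Ioo (t m) (t (m + 1)) := by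
  induction N with
  | zero => exact absurd (hx.1.trans hx.2) (lt_irrefl _)
  | succ N ih =>
    rcases lt_trichotomy x (t N) with h | h | h
    · obtain ⟨m, hm, hxm⟩ := ih ⟨hx.1, h⟩
      exact ⟨m, hm.trans N.lt_succ_self, hxm⟩
    · exact absurd ⟨N, h.symm⟩ hxt
    · exact ⟨N, N.lt_succ_self, h, hx.2⟩

theorem differentiableAt_of_piecewise
    (hF : ∀ m < N, ContDiffOn ℝ 1 F (Icc (t m) (t (m + 1))))
    {x : ℝ} (hx : x ∈ Ioo (t 0) (t N)) (hxt : x ∉ range t) : DifferentiableAt ℝ F x := by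
  obtain ⟨m, hm, hxm⟩ := exists_mem_Ioo_of_piecewise hx hxt
  exact ((hF m hm).differentiableOn one_ne_zero).differentiableAt (Icc_mem_nhds hxm.1 hxm.2)

/-- The function `F` is arbitrary outside `[a, b]`, so its two-sided derivative may fail at the
ends. The derivative within the interval is continuous there and agrees with `G` on the open
interval, which suffices almost everywhere. -/
theorem intervalIntegrable_of_contDiffOn {a b : ℝ} (hab : a ≤ b) (hF : ContDiffOn ℝ 1 F (Icc a b))
    (hG : ∀ x, DifferentiableAt ℝ F x → G x = deriv F x) : IntervalIntegrable G volume a b := by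
  rcases hab.eq_or_lt with rfl | hab'
  · exact IntervalIntegrable.refl
  have h1 : ContinuousOn (derivWithin F (Icc a b)) (Icc a b) :=
    hF.continuousOn_derivWithin (uniqueDiffOn_Icc hab') le_rfl
  have h2 : IntervalIntegrable (derivWithin F (Icc a b)) volume a b :=
    ContinuousOn.intervalIntegrable (by rwa [uIcc_of_le hab])
  rw [intervalIntegrable_iff_integrableOn_Ioo_of_le hab] at h2 ⊢
  refine h2.congr_fun (fun x hx => ?_) measurableSet_Ioo
  have hd := (hF.differentiableOn one_ne_zero).differentiableAt (Icc_mem_nhds hx.1 hx.2)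
  rw [hG x hd]
  exact derivWithin_of_mem_nhds (Icc_mem_nhds hx.1 hx.2)

theorem intervalIntegrable_of_piecewise (ht : Monotone t)
    (hF : ∀ m < N, ContDiffOn ℝ 1 F (Icc (t m) (t (m + 1))))
    (hG : ∀ x, DifferentiableAt ℝ F x → G x = deriv F x) :
    IntervalIntegrable G volume (t 0) (t N) :=
  IntervalIntegrable.trans_iterate fun m hm =>
    intervalIntegrable_of_contDiffOn (ht m.le_succ) (hF m hm) hG

/-- The affine reparametrization on `[0,1]` of a piecewise differentiable path is admissible. -/
theorem isAdmissiblePath_of_piecewise {a b : ℝ} (hab : a ≤ b) (ht : Monotone t) (ha : t 0 = a)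
    (hb : t N = b) (hF : ∀ m < N, ContDiffOn ℝ 1 F (Icc (t m) (t (m + 1))))
    (hG : ∀ x, DifferentiableAt ℝ F x → G x = deriv F x) (hu : ∀ x ∈ Icc a b, IsUnit (F x)) :
    IsAdmissiblePath (fun s => F (a + (b - a) * s)) (fun s => (b - a) • G (a + (b - a) * s)) := by
  have hmaps : ∀ s ∈ Icc (0 : ℝ) 1, a + (b - a) * s ∈ Icc a b := fun s hs =>
    ⟨by nlinarith [hs.1], by nlinarith [hs.2]⟩
  -- When `a = b` the reparametrization is constant, not injective, and the preimage of the
  -- subdivision need not be countable.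
  rcases hab.eq_or_lt with rfl | hab'
  · simp only [sub_self, zero_mul, add_zero, zero_smul]
    exact isAdmissiblePath_of_hasDerivAt (fun x => hasDerivAt_const x _) continuous_const
      fun x _ => hu _ ⟨le_rfl, le_rfl⟩
  have hpos : 0 < b - a := sub_pos.2 hab'
  refine ⟨?_, ⟨(fun s => a + (b - a) * s) ⁻¹' range t, ?_, ?_⟩, ?_, fun s hs => hu _ (hmaps s hs)⟩
  · have h1 := continuousOn_of_piecewise ht fun m hm => (hF m hm).continuousOn
    rw [ha, hb] at h1
    exact h1.comp (by fun_prop) hmaps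
  · refine (countable_range t).preimage fun s s' h => ?_
    simpa [hpos.ne'] using h
  · rintro s ⟨hs, hst⟩
    have hx : a + (b - a) * s ∈ Ioo (t 0) (t N) := by
      rw [ha, hb]
      exact ⟨by nlinarith [hs.1], by nlinarith [hs.2]⟩
    have hd := differentiableAt_of_piecewise hF hx hst
    rw [hG _ hd]
    refine hd.hasDerivAt.scomp s ?_
    simpa using ((hasDerivAt_id s).const_mul (b - a)).const_add a
  · refine IntervalIntegrable.smul ?_ _
    have h1 := intervalIntegrable_of_piecewise ht hF hG
    rw [ha, hb] at h1
    have h2 := (h1.comp_add_left a).comp_mul_left (c := b - a)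
    simpa [hpos.ne'] using h2

end Piecewise

/-! ### Paths in `GL_n(A)` -/

section GLPath

open MeasureTheory Set

variable {A : Type*} [NormedRing A]

/-- An element of `GL_n(A)` as an element of the Banach algebra `M_n(A)`. -/
def MatAlg.ofGL {n : ℕ} (u : (Matrix (Fin n) (Fin n) A)ˣ) : MatAlg n A := u.val

theorem MatAlg.inverse_ofGL {n : ℕ} (u : (Matrix (Fin n) (Fin n) A)ˣ) :
    Ring.inverse (MatAlg.ofGL u) = MatAlg.ofGL u⁻¹ :=
  Ring.inverse_unit (M₀ := MatAlg n A) u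

theorem MatAlg.isUnit_ofGL {n : ℕ} (u : (Matrix (Fin n) (Fin n) A)ˣ) :
    IsUnit (MatAlg.ofGL u) :=
  ⟨u, rfl⟩

/-- An equality in a direct limit already holds at a finite stage, and persists at all later ones;
both ends of a path can then be treated at one common size. -/
theorem GLInf.exists_padOne_eq {k l : ℕ} {u : (Matrix (Fin k) (Fin k) A)ˣ}
    {v : (Matrix (Fin l) (Fin l) A)ˣ} (h : GLInf.of k u = GLInf.of l v) :
    ∃ N, k ≤ N ∧ l ≤ N ∧ ∀ n, N ≤ n → padOne n u.val = padOne n v.val := by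
  obtain ⟨N, hk, hl, hN⟩ := Quotient.exact h
  refine ⟨N, hk, hl, fun n hn => ?_⟩
  have h1 : padOne N u.val = padOne N v.val := congrArg Units.val hN
  rw [← padOne_padOne hk, ← padOne_padOne hl, h1]

/-- The inclusion `x ↦ (x 0; 0 1)` of `M_k(A)` into `M_n(A)`. -/
def MatAlg.padOne {k : ℕ} (n : ℕ) (x : MatAlg k A) : MatAlg n A :=
  BanachDet.padOne (R := A) (k := k) n x

theorem padZero_mul_padOne {k n : ℕ} (h : k ≤ n) (x y : Matrix (Fin k) (Fin k) A) :
    padZero n x * padOne n y = padZero n (x * y) := by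
  rw [padOne_eq, mul_add, mul_sub, ← padZero_mul h, ← padZero_mul h, mul_one, mul_one, sub_self,
    add_zero]

theorem MatAlg.padOne_ofGL {k n : ℕ} (h : k ≤ n) (u : (Matrix (Fin k) (Fin k) A)ˣ) :
    MatAlg.padOne n (MatAlg.ofGL u) = MatAlg.ofGL (glPad k n h u) := rfl

theorem MatAlg.exists_ofGL {n : ℕ} {x : MatAlg n A} (hx : IsUnit x) :
    ∃ u : (Matrix (Fin n) (Fin n) A)ˣ, MatAlg.ofGL u = x := hx

theorem padZero_add {k n : ℕ} (x y : Matrix (Fin k) (Fin k) A) :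
    padZero n (x + y) = padZero n x + padZero n y := by
  ext i j
  simp only [padZero, Matrix.of_apply, Matrix.add_apply]
  split_ifs <;> simp

theorem continuous_padZero (k n : ℕ) : Continuous (padZero (R := A) (k := k) n) := by
  have h : Continuous fun x : Matrix (Fin k) (Fin k) A =>
      padOne n x - (1 - padZero n (1 : Matrix (Fin k) (Fin k) A)) :=
    (continuous_padOne k n).sub continuous_const
  simpa only [padOne_eq, add_sub_cancel_right] using h

variable [NormedAlgebra ℂ A]

/-- The reparametrization on `[0,1]` of a path in `GL_n(A)`. -/
def GLPath.unitPath (ξ : GLPath A) (s : ℝ) : MatAlg ξ.n A :=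
  MatAlg.ofGL (ξ.toFun (ξ.a + (ξ.b - ξ.a) * s))

/-- The derivative `GLPath.dot`, in the Banach algebra `M_n(A)`. -/
def GLPath.dotAlg (ξ : GLPath A) (s : ℝ) : MatAlg ξ.n A := ξ.dot s

/-- The derivative of `unitPath`. -/
def GLPath.unitDot (ξ : GLPath A) (s : ℝ) : MatAlg ξ.n A :=
  (ξ.b - ξ.a) • ξ.dotAlg (ξ.a + (ξ.b - ξ.a) * s)

theorem GLPath.unitPath_zero (ξ : GLPath A) : ξ.unitPath 0 = MatAlg.ofGL (ξ.toFun ξ.a) := by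
  simp [GLPath.unitPath]

theorem GLPath.unitPath_one (ξ : GLPath A) : ξ.unitPath 1 = MatAlg.ofGL (ξ.toFun ξ.b) := by
  simp [GLPath.unitPath]

theorem GLPath.isAdmissiblePath (ξ : GLPath A) : IsAdmissiblePath ξ.unitPath ξ.unitDot := by
  obtain ⟨N, t, ht, ha, hb, hF⟩ := ξ.piecewiseDiff
  refine isAdmissiblePath_of_piecewise (F := fun s => MatAlg.ofGL (ξ.toFun s))
    (G := ξ.dotAlg) ξ.le ht ha hb
    (fun m hm => MatAlg.contDiffOn_of_entry (k := 1) fun i j => hF m hm i j) (fun x hx => ?_)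
    fun x _ => MatAlg.isUnit_ofGL _
  -- Where the path is differentiable in norm, the entrywise derivative is the derivative in
  -- `M_n(A)`.
  refine Matrix.ext fun i j => ?_
  exact (((MatAlg.entryCLM (A := A) (n := ξ.n) i j).restrictScalars ℝ).hasFDerivAt.comp_hasDerivAt x
    hx.hasDerivAt).deriv

theorem GLPath.deltaTilde_eq (τ : BTrace A) (ξ : GLPath A) :
    deltaTilde τ ξ =
      (2 * Real.pi * Complex.I)⁻¹ * logIntegral (τ.toMat ξ.n) ξ.unitPath ξ.unitDot := by
  have h0 : ∀ s, τ.mat (ξ.dot s * (↑(ξ.toFun s)⁻¹ : Matrix (Fin ξ.n) (Fin ξ.n) A)) =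
      (τ.toMat ξ.n).toCLM (ξ.dotAlg s * MatAlg.ofGL (ξ.toFun s)⁻¹) := fun s =>
    (τ.toMat_apply (n := ξ.n) _).symm
  simp only [deltaTilde, one_div, h0]
  congr 1
  have h := intervalIntegral.smul_integral_comp_add_mul (a := 0) (b := 1)
    (fun s => (τ.toMat ξ.n).toCLM (ξ.dotAlg s * MatAlg.ofGL (ξ.toFun s)⁻¹))
    (ξ.b - ξ.a) ξ.a
  rw [mul_zero, mul_one, add_zero, add_sub_cancel] at h
  rw [← h, logIntegral, ← intervalIntegral.integral_smul]
  refine intervalIntegral.integral_congr fun s _ => ?_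
  simp only [GLPath.unitPath, GLPath.unitDot, MatAlg.inverse_ofGL]
  rw [smul_mul_assoc]
  exact (map_smul ((τ.toMat ξ.n).toCLM.restrictScalars ℝ) (ξ.b - ξ.a) _).symm

/-! ### Stabilization -/

theorem padZero_smul {k n : ℕ} (c : ℂ) (x : Matrix (Fin k) (Fin k) A) :
    padZero n (c • x) = c • padZero n x := by
  ext i j
  simp only [padZero, Matrix.of_apply, Matrix.smul_apply]
  split_ifs <;> simp

/-- The inclusion `M_k(A) ⊆ M_n(A)` as a continuous linear map. -/
def padZeroCLM (k n : ℕ) : MatAlg k A →L[ℂ] MatAlg n A where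
  toFun x := padZero (R := A) (k := k) n x
  map_add' x y := padZero_add (A := A) x y
  map_smul' c x := padZero_smul (A := A) c x
  cont := continuous_padZero (A := A) k n

theorem MatAlg.padOne_eq {k n : ℕ} (x : MatAlg k A) :
    MatAlg.padOne n x = padZeroCLM k n x + (1 - padZeroCLM k n 1) :=
  BanachDet.padOne_eq (R := A) (k := k) x

theorem BTrace.mat_padZero (τ : BTrace A) {k n : ℕ} (h : k ≤ n) (x : Matrix (Fin k) (Fin k) A) :
    τ.mat (padZero n x) = τ.mat x := by
  rw [padZero_eq h, τ.mat_mul_comm, ← Matrix.mul_assoc, inclMat_transpose_mul h, Matrix.one_mul]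

theorem BTrace.toMat_padZeroCLM (τ : BTrace A) {k n : ℕ} (h : k ≤ n) (x : MatAlg k A) :
    (τ.toMat n).toCLM (padZeroCLM k n x) = (τ.toMat k).toCLM x := by
  rw [BTrace.toMat_apply, BTrace.toMat_apply]
  exact τ.mat_padZero h x

theorem IsAdmissiblePath.pad {k n : ℕ} (h : k ≤ n) {f f' : ℝ → MatAlg k A}
    (hf : IsAdmissiblePath f f') :
    IsAdmissiblePath (fun s => MatAlg.padOne n (f s)) (fun s => padZeroCLM k n (f' s)) where
  continuousOn := by
    simp only [MatAlg.padOne_eq]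
    exact ((padZeroCLM (A := A) k n).continuous.comp_continuousOn hf.continuousOn).add continuousOn_const
  hasDerivAt := by
    obtain ⟨s, hs, hsd⟩ := hf.hasDerivAt
    refine ⟨s, hs, fun x hx => ?_⟩
    simp only [MatAlg.padOne_eq]
    exact (((padZeroCLM (A := A) k n).restrictScalars ℝ).hasFDerivAt.comp_hasDerivAt x
      (hsd x hx)).add_const _
  intervalIntegrable := ⟨(padZeroCLM (A := A) k n).integrable_comp hf.intervalIntegrable.1,
    (padZeroCLM (A := A) k n).integrable_comp hf.intervalIntegrable.2⟩
  isUnit x hx := by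
    obtain ⟨u, hu⟩ := MatAlg.exists_ofGL (hf.isUnit x hx)
    rw [← hu, MatAlg.padOne_ofGL h]
    exact MatAlg.isUnit_ofGL _

/-- The added block of the path is the constant `1`, so the derivative is padded by zeros, and
padding by zeros does not change the trace. -/
theorem logIntegral_pad (τ : BTrace A) {k n : ℕ} (h : k ≤ n) {f f' : ℝ → MatAlg k A}
    (hf : IsAdmissiblePath f f') :
    logIntegral (τ.toMat n) (fun s => MatAlg.padOne n (f s))
      (fun s => padZeroCLM k n (f' s)) = logIntegral (τ.toMat k) f f' := by
  refine intervalIntegral.integral_congr fun s hs => ?_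
  rw [uIcc_of_le zero_le_one] at hs
  obtain ⟨u, hu⟩ := MatAlg.exists_ofGL (hf.isUnit s hs)
  simp only
  rw [← hu, MatAlg.padOne_ofGL h, MatAlg.inverse_ofGL, MatAlg.inverse_ofGL,
    ← τ.toMat_padZeroCLM h]
  exact congrArg (τ.toMat n).toCLM (padZero_mul_padOne h (f' s) u⁻¹.val)

variable [CompleteSpace A]

/-- Two admissible paths with the same end points in `GL_∞(A)` have the same logarithmic integral
modulo `2πi τ(K_0(A))`. -/
theorem logIntegral_sub_mem_range (τ : BTrace A) {k l : ℕ} {f f' : ℝ → MatAlg k A}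
    {g g' : ℝ → MatAlg l A} (hf : IsAdmissiblePath f f') (hg : IsAdmissiblePath g g')
    {u₀ u₁ : (Matrix (Fin k) (Fin k) A)ˣ} {v₀ v₁ : (Matrix (Fin l) (Fin l) A)ˣ}
    (hu₀ : f 0 = MatAlg.ofGL u₀) (hu₁ : f 1 = MatAlg.ofGL u₁) (hv₀ : g 0 = MatAlg.ofGL v₀) (hv₁ : g 1 = MatAlg.ofGL v₁)
    (h0 : GLInf.of k u₀ = GLInf.of l v₀) (h1 : GLInf.of k u₁ = GLInf.of l v₁) :
    (2 * Real.pi * Complex.I)⁻¹ * logIntegral (τ.toMat k) f f' -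
      (2 * Real.pi * Complex.I)⁻¹ * logIntegral (τ.toMat l) g g' ∈ τ.onKZero.range := by
  obtain ⟨N, hk, hl, hN⟩ := GLInf.exists_padOne_eq h0
  obtain ⟨N', -, -, hN'⟩ := GLInf.exists_padOne_eq h1
  set n := max N N'
  have hkn : k ≤ n := hk.trans (le_max_left _ _)
  have hln : l ≤ n := hl.trans (le_max_left _ _)
  have e0 := hN n (le_max_left _ _)
  have e1 := hN' n (le_max_right _ _)
  have hF := hf.pad hkn
  have hG := hg.pad hln
  have e0' : MatAlg.padOne n (f 0) = MatAlg.padOne n (g 0) := by rw [hu₀, hv₀]; exact e0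
  have e1' : MatAlg.padOne n (f 1) = MatAlg.padOne n (g 1) := by rw [hu₁, hv₁]; exact e1
  -- At size `n` the end points coincide, so `f g⁻¹` is a loop based at `1`.
  have := logIntegral_loop_mem_range (τ.toMat n) (hF.mul hG.inverse) (by
    simp only [e0', e1']
    exact (Ring.mul_inverse_cancel _ (hG.isUnit 0 ⟨le_rfl, zero_le_one⟩)).trans
      (Ring.mul_inverse_cancel _ (hG.isUnit 1 ⟨zero_le_one, le_rfl⟩)).symm)
  rw [logIntegral_mul _ hF hG.inverse, logIntegral_inverse _ hG, logIntegral_pad τ hkn hf,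
    logIntegral_pad τ hln hg, mul_add, mul_neg, ← sub_eq_add_neg] at this
  exact τ.range_toMat_le n this

/-- `Δ_τ` can be computed along any admissible path. -/
theorem delta_eq_logIntegral (τ : BTrace A) (x : GLInfZero A) (hx : ∃ ξ : GLPath A, ξ.Joins 1 x)
    {n : ℕ} {f f' : ℝ → MatAlg n A} (hf : IsAdmissiblePath f f')
    {u₀ u₁ : (Matrix (Fin n) (Fin n) A)ˣ} (hu₀ : f 0 = MatAlg.ofGL u₀) (hu₁ : f 1 = MatAlg.ofGL u₁)
    (h0 : GLInf.of n u₀ = 1) (h1 : GLInf.of n u₁ = x) :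
    delta τ x = (((2 * Real.pi * Complex.I)⁻¹ * logIntegral (τ.toMat n) f f' : ℂ) :
      ℂ ⧸ τ.onKZero.range) := by
  rw [delta, dif_pos hx]
  have hj := hx.choose_spec
  rw [GLPath.deltaTilde_eq, QuotientAddGroup.eq, neg_add_eq_sub]
  exact logIntegral_sub_mem_range τ hf hx.choose.isAdmissiblePath hu₀ hu₁
    (v₀ := hx.choose.toFun hx.choose.a) (v₁ := hx.choose.toFun hx.choose.b)
    (GLPath.unitPath_zero _) (GLPath.unitPath_one _) (h0.trans hj.1.symm)
    (h1.trans hj.2.symm)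

theorem delta_eq_deltaTilde (τ : BTrace A) (x : GLInfZero A) (ξ : GLPath A) (hξ : ξ.Joins 1 x) :
    delta τ x = ((deltaTilde τ ξ : ℂ) : ℂ ⧸ τ.onKZero.range) := by
  rw [GLPath.deltaTilde_eq]
  exact delta_eq_logIntegral τ x ⟨ξ, hξ⟩ ξ.isAdmissiblePath (u₀ := ξ.toFun ξ.a)
    (u₁ := ξ.toFun ξ.b) ξ.unitPath_zero ξ.unitPath_one hξ.1 hξ.2

end GLPath

/-! ### Existence of paths -/

section Reachable

open Set

variable {A : Type*} [NormedRing A] [NormedAlgebra ℂ A] [CompleteSpace A]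

omit [NormedAlgebra ℂ A] in
theorem MatAlg.isOpenEmbedding_ofGL (n : ℕ) :
    Topology.IsOpenEmbedding (MatAlg.ofGL (A := A) (n := n)) :=
  Units.isOpenEmbedding_val (R := MatAlg n A)

omit [NormedAlgebra ℂ A] in
/-- A path in `GL_n(A)` starting at `1` stays in `GL_∞^0(A)`. -/
theorem mem_GLInfZero_of_continuousOn {n : ℕ} {u : ℝ → (Matrix (Fin n) (Fin n) A)ˣ}
    (hu : ContinuousOn (fun s => MatAlg.ofGL (u s)) (Icc 0 1)) (h0 : u 0 = 1) {s : ℝ}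
    (hs : s ∈ Icc (0 : ℝ) 1) : GLInf.of n (u s) ∈ GLInfZero A := by
  have h1 : ContinuousOn u (Icc 0 1) :=
    (MatAlg.isOpenEmbedding_ofGL n).isInducing.continuousOn_iff.2 hu
  have h2 := isPreconnected_Icc.image _ ((GLInf.continuous_of n).comp_continuousOn h1)
  refine h2.subset_connectedComponent (x := 1) ⟨0, ⟨le_rfl, zero_le_one⟩, ?_⟩ ⟨s, hs, rfl⟩
  simp [h0]

/-- `x` is the end point of a `C¹` path in some `GL_n(A)` starting at `1`. -/
def IsReachable (x : GLInf A) : Prop :=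
  ∃ (n : ℕ) (u : ℝ → (Matrix (Fin n) (Fin n) A)ˣ),
    ContDiffOn ℝ 1 (fun s => MatAlg.ofGL (u s)) (Icc 0 1) ∧ u 0 = 1 ∧ GLInf.of n (u 1) = x

omit [CompleteSpace A] in
theorem contDiffOn_glPad {k n : ℕ} (h : k ≤ n) {u : ℝ → (Matrix (Fin k) (Fin k) A)ˣ}
    (hu : ContDiffOn ℝ 1 (fun s => MatAlg.ofGL (u s)) (Icc 0 1)) :
    ContDiffOn ℝ 1 (fun s => MatAlg.ofGL (glPad k n h (u s))) (Icc 0 1) := by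
  simp only [← MatAlg.padOne_ofGL h, MatAlg.padOne_eq]
  exact (((padZeroCLM (A := A) k n).restrictScalars ℝ).contDiff.comp_contDiffOn hu).add
    contDiffOn_const

omit [CompleteSpace A] in
-- The pointwise product of the padded paths stays `C¹`, which a concatenation need not.
theorem IsReachable.mul {x y : GLInf A} (hx : IsReachable x) (hy : IsReachable y) :
    IsReachable (x * y) := by
  obtain ⟨k, u, hu, hu0, rfl⟩ := hx
  obtain ⟨l, v, hv, hv0, rfl⟩ := hy
  have hk := le_max_left k l
  have hl := le_max_right k l
  refine ⟨max k l, fun s => glPad k _ hk (u s) * glPad l _ hl (v s), ?_, ?_, ?_⟩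
  · exact (contDiffOn_glPad hk hu).mul (contDiffOn_glPad hl hv)
  · simp [hu0, hv0]
  · simp [GLInf.of_glPad]

/-- The segment from `1` to `v` stays in the open unit ball about `1`, which consists of invertible
elements. -/
theorem isReachable_of_norm_sub_one_lt {n : ℕ} (v : (Matrix (Fin n) (Fin n) A)ˣ)
    (hv : ‖MatAlg.ofGL v - 1‖ < 1) : IsReachable (GLInf.of n v) := by
  set f : ℝ → MatAlg n A := fun s => 1 + s • (MatAlg.ofGL v - 1) with hf
  have hunit : ∀ s ∈ Icc (0 : ℝ) 1, IsUnit (f s) := by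
    intro s hs
    have := isUnit_one_sub_of_norm_lt_one (x := -(s • (MatAlg.ofGL v - 1))) (by
      rw [norm_neg, norm_smul, Real.norm_of_nonneg hs.1]
      exact (mul_le_of_le_one_left (norm_nonneg _) hs.2).trans_lt hv)
    rwa [sub_neg_eq_add] at this
  -- A path of units must be defined on all of `ℝ`; the value `1` outside `[0, 1]` is arbitrary.
  have hex : ∀ s, ∃ u : (Matrix (Fin n) (Fin n) A)ˣ, s ∈ Icc (0 : ℝ) 1 → MatAlg.ofGL u = f s := by
    intro s
    by_cases hs : s ∈ Icc (0 : ℝ) 1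
    · obtain ⟨u, hu⟩ := MatAlg.exists_ofGL (hunit s hs)
      exact ⟨u, fun _ => hu⟩
    · exact ⟨1, fun h => absurd h hs⟩
  choose u hu using hex
  have hinj := (MatAlg.isOpenEmbedding_ofGL (A := A) n).injective
  refine ⟨n, u, ?_, ?_, ?_⟩
  · have : ContDiff ℝ 1 f := contDiff_const.add (contDiff_id.smul contDiff_const)
    exact this.contDiffOn.congr hu
  · refine hinj ((hu 0 ⟨le_rfl, zero_le_one⟩).trans ?_)
    simp only [hf, zero_smul, add_zero]
    rfl
  · congr 1
    refine hinj ((hu 1 ⟨zero_le_one, le_rfl⟩).trans ?_)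
    simp [hf]

omit [NormedAlgebra ℂ A] in
theorem isOpen_norm_ofGL_sub_one_lt {n : ℕ}
    {φ : (Matrix (Fin n) (Fin n) A)ˣ → (Matrix (Fin n) (Fin n) A)ˣ} (hφ : Continuous φ) :
    IsOpen {w | ‖MatAlg.ofGL (φ w) - 1‖ < 1} := by
  have h := (MatAlg.isOpenEmbedding_ofGL (A := A) n).continuous.comp hφ
  exact isOpen_lt (h.sub continuous_const).norm continuous_const

/-- For `w` near `v` in `GL_n(A)`, both `w v⁻¹` and `v w⁻¹` are near `1`, hence reachable, so `v`
and `w` are reachable together. In the inductive limit topology it suffices to check openness in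
each `GL_n(A)`. -/
theorem isClopen_isReachable : IsClopen {x : GLInf A | IsReachable x} := by
  have hone : ∀ n : ℕ, MatAlg.ofGL (1 : (Matrix (Fin n) (Fin n) A)ˣ) - 1 = 0 := fun n =>
    sub_self (1 : MatAlg n A)
  constructor
  · refine ⟨isOpen_iSup_iff.2 fun n => isOpen_coinduced.2 (isOpen_iff_mem_nhds.2 fun v hv => ?_)⟩
    have hopen := isOpen_norm_ofGL_sub_one_lt (A := A) (n := n) (φ := fun w => v * w⁻¹) (by fun_prop)
    refine Filter.mem_of_superset (hopen.mem_nhds ?_) fun w hw hw' => hv ?_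
    · simp [hone]
    · have := (isReachable_of_norm_sub_one_lt _ hw).mul hw'
      rwa [← map_mul, inv_mul_cancel_right] at this
  · refine isOpen_iSup_iff.2 fun n => isOpen_coinduced.2 (isOpen_iff_mem_nhds.2 fun v hv => ?_)
    have hopen := isOpen_norm_ofGL_sub_one_lt (A := A) (n := n) (φ := fun w => w * v⁻¹) (by fun_prop)
    refine Filter.mem_of_superset (hopen.mem_nhds ?_) fun w hw => ?_
    · simp [hone]
    · have := (isReachable_of_norm_sub_one_lt _ hw).mul hv
      rwa [← map_mul, inv_mul_cancel_right] at this

theorem isReachable_of_mem {x : GLInf A} (hx : x ∈ GLInfZero A) : IsReachable x :=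
  isClopen_isReachable.connectedComponent_subset
    (show IsReachable (1 : GLInf A) from ⟨0, fun _ => 1, contDiffOn_const, rfl, map_one _⟩) hx

theorem exists_GLPath {x : GLInf A} (hx : x ∈ GLInfZero A) : ∃ ξ : GLPath A, ξ.Joins 1 x := by
  obtain ⟨n, u, hu, hu0, hu1⟩ := isReachable_of_mem hx
  -- A single `C¹` piece: the subdivision is `0` at index `0` and `1` from index `1` on.
  refine ⟨⟨n, 0, 1, zero_le_one, u, ⟨1, fun m => if m = 0 then 0 else 1, ?_, rfl, rfl, ?_⟩, ?_⟩, ?_, hu1⟩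
  · intro a b hab
    rcases Nat.eq_zero_or_pos a with rfl | ha
    · by_cases hb : b = 0 <;> simp [hb]
    · simp [ha.ne', (ha.trans_le hab).ne']
  · intro m hm i j
    obtain rfl : m = 0 := by omega
    simpa using! MatAlg.contDiffOn_entry (k := 1) hu i j
  · exact fun s hs => mem_GLInfZero_of_continuousOn hu.continuousOn hu0 hs
  · change GLInf.of n (u 0) = 1
    rw [hu0, map_one]

end Reachable

/-! ### The determinant -/

section Determinant

open Set

variable {A : Type*} [NormedRing A] [NormedAlgebra ℂ A]

theorem expDelta_eq_exp (τ : BTrace A) (h : τ.onKZero.range = intSubgroup) (x : GLInfZero A)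
    {w : ℂ} (hw : delta τ x = (w : ℂ ⧸ τ.onKZero.range)) :
    (expDelta τ h x : ℂ) = Complex.exp (2 * Real.pi * Complex.I * w) := by
  rw [expDelta, hw]
  rfl

variable [CompleteSpace A]

theorem expDelta_eq_exp_logIntegral (τ : BTrace A) (h : τ.onKZero.range = intSubgroup)
    (x : GLInfZero A) {n : ℕ} {f f' : ℝ → MatAlg n A} (hf : IsAdmissiblePath f f')
    {u₀ u₁ : (Matrix (Fin n) (Fin n) A)ˣ} (hu₀ : f 0 = MatAlg.ofGL u₀)
    (hu₁ : f 1 = MatAlg.ofGL u₁) (h0 : GLInf.of n u₀ = 1) (h1 : GLInf.of n u₁ = x) :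
    (expDelta τ h x : ℂ) = Complex.exp (logIntegral (τ.toMat n) f f') := by
  rw [expDelta_eq_exp τ h x
    (delta_eq_logIntegral τ x (exists_GLPath x.2) hf hu₀ hu₁ h0 h1),
    mul_inv_cancel_left₀ Complex.two_pi_I_ne_zero]

/-- The pointwise product of padded paths to `x` and to `y` is a path from `1` to `xy`, whose
logarithmic integral is the sum of theirs. Any admissible path computes `Δ_τ`, so the product need
not be repackaged as a `GLPath`. -/
theorem expDelta_mul (τ : BTrace A) (h : τ.onKZero.range = intSubgroup) (x y : GLInfZero A) :
    expDelta τ h (x * y) = expDelta τ h x * expDelta τ h y := by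
  obtain ⟨ξ, hξ0, hξ1⟩ := exists_GLPath x.2
  obtain ⟨η, hη0, hη1⟩ := exists_GLPath y.2
  have hk := le_max_left ξ.n η.n
  have hl := le_max_right ξ.n η.n
  have hF := ξ.isAdmissiblePath.pad hk
  have hG := η.isAdmissiblePath.pad hl
  refine Units.ext ?_
  rw [Units.val_mul, expDelta_eq_exp_logIntegral τ h x ξ.isAdmissiblePath ξ.unitPath_zero
    ξ.unitPath_one hξ0 hξ1, expDelta_eq_exp_logIntegral τ h y η.isAdmissiblePath η.unitPath_zero
    η.unitPath_one hη0 hη1, ← Complex.exp_add, ← logIntegral_pad τ hk ξ.isAdmissiblePath,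
    ← logIntegral_pad τ hl η.isAdmissiblePath, ← logIntegral_mul _ hF hG]
  refine expDelta_eq_exp_logIntegral τ h (x * y) (hF.mul hG)
    (u₀ := glPad _ _ hk (ξ.toFun ξ.a) * glPad _ _ hl (η.toFun η.a))
    (u₁ := glPad _ _ hk (ξ.toFun ξ.b) * glPad _ _ hl (η.toFun η.b)) ?_ ?_ ?_ ?_
  · rw [ξ.unitPath_zero, η.unitPath_zero]
    rfl
  · rw [ξ.unitPath_one, η.unitPath_one]
    rfl
  · rw [map_mul, GLInf.of_glPad, GLInf.of_glPad, hξ0, hη0, one_mul]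
  · rw [map_mul, GLInf.of_glPad, GLInf.of_glPad, hξ1, hη1]
    rfl

/-- The map `exp(2πi Δ_τ)` as a group homomorphism. -/
def expDeltaHom (τ : BTrace A) (h : τ.onKZero.range = intSubgroup) : GLInfZero A →* ℂˣ :=
  MonoidHom.mk' (expDelta τ h) (expDelta_mul τ h)

theorem MatAlg.ofGL_expGL {n : ℕ} (y : MatAlg n A) :
    MatAlg.ofGL (expGL (A := A) (n := n) y) = NormedSpace.exp y := rfl

theorem hasDerivAt_exp_smul {n : ℕ} (y : MatAlg n A) (s : ℝ) :
    HasDerivAt (fun s : ℝ => NormedSpace.exp (s • y)) (NormedSpace.exp (s • y) * y) s :=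
  hasDerivAt_exp_smul_const (𝕂 := ℝ) y s

theorem isAdmissiblePath_exp {n : ℕ} (y : MatAlg n A) :
    IsAdmissiblePath (fun s : ℝ => NormedSpace.exp (s • y))
      (fun s : ℝ => NormedSpace.exp (s • y) * y) := by
  refine isAdmissiblePath_of_hasDerivAt (hasDerivAt_exp_smul y) ?_ fun s _ => ?_
  · exact (continuous_iff_continuousAt.2 fun s => (hasDerivAt_exp_smul y s).continuousAt).mul
      continuous_const
  · rw [← MatAlg.ofGL_expGL]
    exact MatAlg.isUnit_ofGL _

/-- The derivative of `e^{sy}` is `e^{sy} y`, so by conjugation invariance the integrand is the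
constant `T(y)`. -/
theorem logIntegral_exp {n : ℕ} (T : BTrace (MatAlg n A)) (y : MatAlg n A) :
    logIntegral T (fun s : ℝ => NormedSpace.exp (s • y))
      (fun s : ℝ => NormedSpace.exp (s • y) * y) = T.toCLM y := by
  have h : ∀ s : ℝ, T.toCLM (NormedSpace.exp (s • y) * y *
      Ring.inverse (NormedSpace.exp (s • y))) = T.toCLM y := by
    intro s
    rw [T.tracial, ← mul_assoc, Ring.inverse_mul_cancel, one_mul]
    rw [← MatAlg.ofGL_expGL]
    exact MatAlg.isUnit_ofGL _
  simp [logIntegral, h]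

omit [CompleteSpace A] in
theorem exp_zero_smul_eq_ofGL {n : ℕ} (y : MatAlg n A) :
    NormedSpace.exp ((0 : ℝ) • y) = MatAlg.ofGL 1 := by
  rw [zero_smul, NormedSpace.exp_zero]
  rfl

theorem exp_one_smul_eq_ofGL {n : ℕ} (y : MatAlg n A) :
    NormedSpace.exp ((1 : ℝ) • y) = MatAlg.ofGL (expGL (A := A) (n := n) y) := by
  rw [one_smul]
  rfl

theorem expGL_zero (n : ℕ) : expGL (0 : Matrix (Fin n) (Fin n) A) = 1 :=
  Units.ext (NormedSpace.exp_zero (𝔸 := MatAlg n A))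

theorem expGL_mem (n : ℕ) (y : Matrix (Fin n) (Fin n) A) : GLInf.of n (expGL y) ∈ GLInfZero A := by
  have h := mem_GLInfZero_of_continuousOn (A := A) (n := n)
    (u := fun s => expGL (A := A) (n := n) (s • (show MatAlg n A from y)))
    (isAdmissiblePath_exp (A := A) (n := n) y).continuousOn ?_ (s := 1) ⟨zero_le_one, le_rfl⟩
  · rwa [one_smul] at h
  · rw [zero_smul]
    exact expGL_zero n

theorem expDelta_expGL (τ : BTrace A) (h : τ.onKZero.range = intSubgroup) (n : ℕ)
    (y : Matrix (Fin n) (Fin n) A) :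
    (expDelta τ h ⟨GLInf.of n (expGL y), expGL_mem n y⟩ : ℂ) = Complex.exp (τ.mat y) := by
  have h1 := expDelta_eq_exp_logIntegral τ h ⟨GLInf.of n (expGL y), expGL_mem n y⟩
    (isAdmissiblePath_exp (A := A) (n := n) y) (u₀ := 1) (u₁ := expGL y)
    (exp_zero_smul_eq_ofGL y) (exp_one_smul_eq_ofGL y) (map_one _) rfl
  refine h1.trans (congrArg Complex.exp ?_)
  exact (logIntegral_exp (A := A) (n := n) (τ.toMat n) y).trans (τ.toMat_apply (n := n) y)

end Determinant

/-! ### The case of the complex numbers -/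

section Complex

theorem idTrace_mat {n : ℕ} (x : Matrix (Fin n) (Fin n) ℂ) : idTrace.mat x = x.trace := rfl

/-- Over `ℂ` the trace of an idempotent is its rank, an integer; conversely the idempotent `1` gives
a generator. -/
theorem range_onKZero_idTrace : idTrace.onKZero.range = intSubgroup := by
  refine le_antisymm (BTrace.range_onKZero_le _ fun e => ?_) ?_
  · have h : IsIdempotentElem (Matrix.toLin' e.mat) := by
      rw [IsIdempotentElem, Module.End.mul_eq_comp, ← Matrix.toLin'_mul, e.idem]
    rw [idTrace_mat, ← Matrix.trace_toLin'_eq, (LinearMap.IsIdempotentElem.isProj_range _ h).trace]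
    exact ⟨Module.finrank ℂ (LinearMap.range (Matrix.toLin' e.mat)), by simp⟩
  · rintro _ ⟨m, rfl⟩
    have h : (1 : ℂ) ∈ idTrace.onKZero.range := idTrace.apply_mem_range (p := 1) (one_mul 1)
    simpa using zsmul_mem h m

theorem exp_eq_one_add {M : Type*} [NormedRing M] [NormedAlgebra ℂ M] {y : M} (hy : y * y = 0) :
    NormedSpace.exp y = 1 + y := by
  rw [NormedSpace.exp_eq_tsum ℂ]
  have : ∀ k ∉ Finset.range 2, ((k.factorial : ℂ)⁻¹) • y ^ k = 0 := by
    intro k hk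
    obtain ⟨m, rfl⟩ : ∃ m, k = m + 2 := ⟨k - 2, by simp at hk; omega⟩
    rw [pow_add, pow_two, hy, mul_zero, smul_zero]
  simp only
  rw [tsum_eq_sum this]
  simp [Finset.sum_range_succ]

/-- A diagonal matrix with nonzero entries is the exponential of the diagonal matrix of their
logarithms, and the exponential of a sum is the product of the exponentials. -/
theorem expDelta_idTrace_diagonal {n : ℕ} (D : Fin n → ℂ) (hD : (Matrix.diagonal D).det ≠ 0)
    (x : (Matrix (Fin n) (Fin n) ℂ)ˣ) (hx : x.val = Matrix.diagonal D) :
    ∃ h : GLInf.of n x ∈ GLInfZero ℂ,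
      (expDelta idTrace range_onKZero_idTrace ⟨GLInf.of n x, h⟩ : ℂ) = (Matrix.diagonal D).det := by
  rw [Matrix.det_diagonal] at hD ⊢
  have hD' : ∀ i, D i ≠ 0 := fun i => Finset.prod_ne_zero_iff.1 hD i (Finset.mem_univ i)
  obtain rfl : x = expGL (Matrix.diagonal fun i => Complex.log (D i)) := by
    refine Units.ext (hx.trans ?_)
    refine Eq.trans ?_ (Matrix.exp_diagonal _).symm
    congr 1
    funext i
    rw [Pi.coe_exp, ← Complex.exp_eq_exp_ℂ, Complex.exp_log (hD' i)]
  refine ⟨expGL_mem _ _, ?_⟩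
  rw [expDelta_expGL, idTrace_mat, Matrix.trace_diagonal, Complex.exp_sum]
  exact Finset.prod_congr rfl fun i _ => Complex.exp_log (hD' i)

/-- A transvection is `1 + y` with `y` off-diagonal, so `y² = 0` and it equals `e^y` with `y` of
trace zero. -/
theorem expDelta_idTrace_transvection {n : ℕ} (t : Matrix.TransvectionStruct (Fin n) ℂ)
    (x : (Matrix (Fin n) (Fin n) ℂ)ˣ) (hx : x.val = t.toMatrix) :
    ∃ h : GLInf.of n x ∈ GLInfZero ℂ,
      (expDelta idTrace range_onKZero_idTrace ⟨GLInf.of n x, h⟩ : ℂ) = t.toMatrix.det := by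
  obtain rfl : x = expGL (Matrix.single t.i t.j t.c) := by
    refine Units.ext (hx.trans ?_)
    exact (exp_eq_one_add (M := MatAlg n ℂ) (y := Matrix.single t.i t.j t.c)
      (Matrix.single_mul_single_of_ne t.c t.i t.j t.i t.hij.symm t.c)).symm
  refine ⟨expGL_mem _ _, ?_⟩
  rw [expDelta_expGL, idTrace_mat, Matrix.trace_single_eq_of_ne _ _ _ t.hij, Complex.exp_zero,
    Matrix.TransvectionStruct.det]

/-- Gaussian elimination: diagonal matrices and transvections generate, and both sides are
multiplicative. Membership in `GL_∞^0(ℂ)` is carried along the same induction, which proves that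
this group is all of `GL_∞(ℂ)`. -/
theorem expDelta_idTrace {n : ℕ} (x : (Matrix (Fin n) (Fin n) ℂ)ˣ) :
    ∃ h : GLInf.of n x ∈ GLInfZero ℂ,
      (expDelta idTrace range_onKZero_idTrace ⟨GLInf.of n x, h⟩ : ℂ) =
        Matrix.det (x : Matrix (Fin n) (Fin n) ℂ) := by
  have hdet : ∀ X : Matrix (Fin n) (Fin n) ℂ, X.det ≠ 0 →
      ∃ u : (Matrix (Fin n) (Fin n) ℂ)ˣ, u.val = X := fun X hX =>
    (Matrix.isUnit_iff_isUnit_det X).2 (isUnit_iff_ne_zero.2 hX)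
  refine Matrix.diagonal_transvection_induction_of_det_ne_zero
    (fun X => ∀ x : (Matrix (Fin n) (Fin n) ℂ)ˣ, x.val = X →
      ∃ h : GLInf.of n x ∈ GLInfZero ℂ,
        (expDelta idTrace range_onKZero_idTrace ⟨GLInf.of n x, h⟩ : ℂ) = X.det)
    x.val ((Matrix.isUnit_iff_isUnit_det _).1 x.isUnit).ne_zero
    expDelta_idTrace_diagonal expDelta_idTrace_transvection ?_ x rfl
  intro X Y hX hY hPX hPY x hx
  obtain ⟨u, rfl⟩ := hdet X hX
  obtain ⟨v, rfl⟩ := hdet Y hY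
  obtain rfl : x = u * v := Units.ext hx
  obtain ⟨hu, hu'⟩ := hPX u rfl
  obtain ⟨hv, hv'⟩ := hPY v rfl
  have huv := mul_mem hu hv
  rw [← map_mul] at huv
  refine ⟨huv, ?_⟩
  rw [Matrix.det_mul, ← hu', ← hv', ← Units.val_mul, ← expDelta_mul]
  congr 2
  exact Subtype.ext (map_mul _ _ _)

end Complex

end BanachDet

end

theorem mainTheorem3 :
    (∀ (A : Type*) [NormedRing A] [NormedAlgebra ℂ A] [CompleteSpace A] (τ : BTrace A)
      (hτ : τ.onKZero.range = intSubgroup),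
      -- `Δ_τ` is well defined
      (∀ x : GLInfZero A, (∃ ξ : GLPath A, ξ.Joins 1 x) ∧
        ∀ ξ : GLPath A, ξ.Joins 1 x →
          delta τ x = ((deltaTilde τ ξ : ℂ) : ℂ ⧸ τ.onKZero.range)) ∧
      -- `exp(2πi Δ_τ)` is a group homomorphism
      (∃ φ : GLInfZero A →* ℂˣ, ⇑φ = expDelta τ hτ) ∧
      -- its value at exponentials
      (∀ (n : ℕ) (y : Matrix (Fin n) (Fin n) A),
        ∃ hy : GLInf.of n (expGL y) ∈ GLInfZero A,
          (expDelta τ hτ ⟨GLInf.of n (expGL y), hy⟩ : ℂ) = Complex.exp (τ.mat y))) ∧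
    -- the case of `ℂ`
    (∃ h : idTrace.onKZero.range = intSubgroup,
      ∀ (n : ℕ) (x : (Matrix (Fin n) (Fin n) ℂ)ˣ),
        ∃ hx : GLInf.of n x ∈ GLInfZero ℂ,
          (expDelta idTrace h ⟨GLInf.of n x, hx⟩ : ℂ) = Matrix.det (x : Matrix (Fin n) (Fin n) ℂ)) := by
  refine ⟨fun A _ _ _ τ hτ => ⟨fun x => ⟨exists_GLPath x.2, fun ξ hξ =>
    delta_eq_deltaTilde τ x ξ hξ⟩, ⟨expDeltaHom τ hτ, rfl⟩, fun n y =>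
    ⟨expGL_mem n y, expDelta_expGL τ hτ n y⟩⟩, range_onKZero_idTrace, fun n x => expDelta_idTrace x⟩
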